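/- **Setting.** Let $\mathcal S\neq\{0\}$ be a finite-dimensional inner product space with Euclidean norm $\|\cdot\|_2$, let $\|\cdot\|$ be another norm on $\mathcal S$, with dual norm $\|X\|_\star=\sup_{\|Z\|\le1}\langle X,Z\rangle$, and let $\underline\rho,\bar\rho>0$ satisfy $\underline\rho\|X\|\le\|X\|_2\le\bar\rho\|X\|$ for all $X$. Let $n\ge1$, $f_j(X)=\mathbb E_{\xi_j\sim\mathcal D_j}[f_j(X;\xi_j)]$ for $j=1,\dots,n$, and $f=\frac1n\sum_{j=1}^n f_j$. Assume that $f\ge f^\star$ for some $f^\star\in\mathbb R$; that $f$ is $L$-smooth and each $f_j$ is $L_j$-smooth, i.e. $\|\nabla f(X)-\nabla f(Y)\|_\star\le L\|X-Y\|$ and $\|\nabla f_j(X)-\nabla f_j(Y)\|_\star\le L_j\|X-Y\|$; and that $\mathbb E_{\xi_j}[\nabla f_j(X;\xi_j)]=\nabla f_j(X)$ and $\mathbb E_{\xi_j}\|\nabla f_j(X;\xi_j)-\nabla f_j(X)\|_2^2\le\sigma^2$ for all $X$, where $\sigma\ge0$. Put $\tilde L=\big(\frac1n\sum_j L_j^2\big)^{1/2}$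 and take $L\le\tilde L$ (no restriction on $f$, since $f$ is always $\tilde L$-smooth). **Algorithm (EF21-Muon).** Start from a deterministic $X^0=W^0\in\mathcal S$ and arbitrary square-integrable, possibly random, $M_j^0,G_j^0$. For $k=0,1,\dots$, with $G^k=\frac1n\sum_jG_j^k$ and radius $t^k=\gamma\|G^k\|_\star$, $$X^{k+1}\in\arg\min_{\|Z-X^k\|\le t^k}\langle G^k,Z\rangle,\qquad W^{k+1}=W^k+\mathcal C^k(X^{k+1}-W^k),$$ $$M_j^{k+1}=(1-\beta)M_j^k+\beta\nabla f_j(W^{k+1};\xi_j^{k+1}),\qquad G_j^{k+1}=G_j^k+\mathcal C_j^k(M_j^{k+1}-G_j^k),$$ where the minimizer is returned by a deterministic (measurable) oracle. Here $\alpha_P,\alpha_D\in(0,1]$, the possibly random maps $\mathcal C^k,\mathcal C^k_j$ satisfy $\mathbb E\|\mathcal C^k(X)-X\|^2\le(1-\alpha_P)\|X\|^2$ and $\mathbb E\|\mathcal C_j^k(X)-X\|_2^2\le(1-\alpha_D)\|X\|_2^2$ for all $X\in\mathcal S$, and the initialization, the server compressors $\mathcal C^k$ ($k\ge0$), the families $(\mathcal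 C_j^k)_{j}$ ($k\ge0$), and the samples $\xi_j^{k+1}\sim\mathcal D_j$ (all $j$ and $k\ge0$) are mutually independent. **Parameters.** With $$\zeta=\frac{\bar\rho^2}{\underline\rho^2}\Big(\frac{12}{\beta^2}L^2+\frac{24(\beta+2)}{\alpha_P^2}L^2+\frac{36(\beta^2+4)}{\alpha_D^2}\tilde L^2+\frac{144\beta^2(2\beta+5)}{\alpha_P^2\alpha_D^2}\tilde L^2\Big)$$ and $$\Psi^0=f(X^0)-f^\star+\frac{6\bar\rho^2\gamma}{\beta}\mathbb E\Big\|\nabla f(X^0)-\frac1n\sum_jM_j^0\Big\|_2^2+\frac{72\bar\rho^2\beta\gamma}{\alpha_D^2}\frac1n\sum_j\mathbb E\|\nabla f_j(X^0)-M_j^0\|_2^2+\frac{6\bar\rho^2\gamma}{\alpha_D}\frac1n\sum_j\mathbb E\|M_j^0-G_j^0\|_2^2,$$ let $K\ge1$, and let the parameters $\gamma$ and $\beta\in(0,1]$ satisfy $$\gamma=\frac1{\sqrt{2\zeta}+2L},\qquad \beta=\min\Big\{1,\Big(\frac{\Psi^0Ln}{\underline\rho^2\sigma^2K}\Big)^{1/2},\Big(\frac{\Psi^0L\alpha_D}{\underline\rho^2\sigma^2K}\Big)^{1/3},\Big(\frac{\Psi^0L\alpha_D^2}{\underline\rho^2\sigma^2K}\Big)^{1/4}\Big\}$$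 (with $\beta=1$ if $\sigma=0$). Since $\Psi^0$ and $\zeta$ depend on $\beta$, the second relation is an equation for $\beta$; for $M_j^0=G_j^0=\nabla f_j(X^0)$ one has $\Psi^0=f(X^0)-f^\star$ and it is explicit. If $L=\tilde L=0$, so that the formula for $\gamma$ reads $1/0$, put $\gamma=0$. **Conclusion.** There is a universal constant $C$ (independent of all the data above) such that $$\gamma^{-1}\le C\Big(\frac{\bar\rho^2L}{\underline\rho^2\beta}+\frac{\bar\rho^2\tilde L}{\underline\rho^2\alpha_P\alpha_D}\Big)$$ (omitted when $L=\tilde L=0$), every $\|\nabla f(X^k)\|_\star^2$ is integrable, and $$\frac1K\sum_{k=0}^{K-1}\mathbb E\|\nabla f(X^k)\|_\star^2\le C\Big[\frac{\Psi^0\bar\rho^2\tilde L}{\underline\rho^2\alpha_P\alpha_DK}+\Big(\frac{\Psi^0\bar\rho^4\sigma^2L}{\underline\rho^2nK}\Big)^{1/2}+\Big(\frac{\Psi^0\bar\rho^3\sigma L}{\underline\rho^2\sqrt{\alpha_D}K}\Big)^{2/3}+\Big(\frac{\Psi^0\underline\rho^{8/3}\sigma^{2/3}L}{\bar\rho^2\alpha_D^{2/3}K}\Big)^{3/4}\Big].$$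 -/

import Mathlib

open MeasureTheory ProbabilityTheory

namespace EF21Muon

/-! ### Geometry of the parameter space

`E` is the finite-dimensional parameter space; `inner` and `‖·‖` are the Euclidean inner product and
norm, and `N` is the arbitrary second norm. -/

section Geometry

variable {E : Type*} [NormedAddCommGroup E] [InnerProductSpace ℝ E]

/-- The dual norm `‖G‖_⋆ = sup {⟪G, Z⟫ : N Z ≤ 1}`. -/
noncomputable def dualNorm (N : Seminorm ℝ E) (G : E) : ℝ :=
  sSup ((fun Z : E => inner ℝ G Z) '' {Z : E | N Z ≤ 1})

/-- `Z` is a value of the linear minimization oracle `LMO_{B(c,t)}(G)`, that is,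
`Z ∈ argmin {⟪G, Z'⟫ : N (Z' - c) ≤ t}`. -/
def IsLMO (N : Seminorm ℝ E) (c : E) (t : ℝ) (G Z : E) : Prop :=
  N (Z - c) ≤ t ∧ ∀ Z' : E, N (Z' - c) ≤ t → inner ℝ G Z ≤ inner ℝ G Z'

/-- Norm equivalence `ρlo N(x) ≤ ‖x‖₂ ≤ ρhi N(x)` with positive constants. The upper bound makes
the seminorm `N` a norm. -/
structure NormEquivalence (N : Seminorm ℝ E) (ρlo ρhi : ℝ) : Prop where
  lo_pos : 0 < ρlo
  hi_pos : 0 < ρhi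
  lower : ∀ x : E, ρlo * N x ≤ ‖x‖
  upper : ∀ x : E, ‖x‖ ≤ ρhi * N x

/-- `L`-smoothness with respect to the norm `N` and its dual. -/
structure IsSmooth [CompleteSpace E] (N : Seminorm ℝ E) (L : ℝ) (f : E → ℝ) : Prop where
  nonneg : 0 ≤ L
  differentiable : Differentiable ℝ f
  lipschitz : ∀ X Y : E, dualNorm N (gradient f X - gradient f Y) ≤ L * N (X - Y)

/-- The randomized map `x ↦ C θ x`, `θ ∼ ν`, is a contractive compressor with parameter
`α ∈ (0, 1]` with respect to the seminorm `p`. -/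
structure IsContractive [MeasurableSpace E] {Θ : Type*} [MeasurableSpace Θ]
    (p : Seminorm ℝ E) (α : ℝ) (ν : Measure Θ) (C : Θ → E → E) : Prop where
  pos : 0 < α
  le_one : α ≤ 1
  measurable : Measurable (fun q : Θ × E => C q.1 q.2)
  integrable : ∀ x : E, Integrable (fun θ => p (C θ x - x) ^ 2) ν
  contract : ∀ x : E, ∫ θ, p (C θ x - x) ^ 2 ∂ν ≤ (1 - α) * p x ^ 2

end Geometry

/-! ### The distributed stochastic optimization problem -/

section Problem

variable {E : Type*} [NormedAddCommGroup E] [InnerProductSpace ℝ E] [CompleteSpace E]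
  {n : ℕ} {Ξ : Fin n → Type*} [∀ j, MeasurableSpace (Ξ j)]

/-- `f_j(X) = E_{ξ ∼ D_j} f_j(X; ξ)`; here `F j X ξ` is the sample loss `f_j(X; ξ)`. -/
noncomputable def localLoss (D : ∀ j, Measure (Ξ j)) (F : ∀ j, E → Ξ j → ℝ) (j : Fin n) (X : E) :
    ℝ :=
  ∫ ξ, F j X ξ ∂(D j)

/-- `f = (1/n) ∑_j f_j`. -/
noncomputable def globalLoss (D : ∀ j, Measure (Ξ j)) (F : ∀ j, E → Ξ j → ℝ) (X : E) : ℝ :=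
  (1 / (n : ℝ)) * ∑ j, localLoss D F j X

/-- The stochastic gradient `∇f_j(X; ξ)`. -/
noncomputable def stochGrad (F : ∀ j, E → Ξ j → ℝ) (j : Fin n) (X : E) (ξ : Ξ j) : E :=
  gradient (fun Y => F j Y ξ) X

/-- The stochastic gradients are well defined, unbiased, and have variance at most `σ²` in the
Euclidean norm. -/
structure BoundedVariance [MeasurableSpace E] (D : ∀ j, Measure (Ξ j)) (F : ∀ j, E → Ξ j → ℝ)
    (σ : ℝ) : Prop where
  sigma_nonneg : 0 ≤ σ
  isProbability : ∀ j, IsProbabilityMeasure (D j)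
  loss_integrable : ∀ j X, Integrable (F j X) (D j)
  loss_differentiable : ∀ j X, ∀ᵐ ξ ∂(D j), DifferentiableAt ℝ (fun Y => F j Y ξ) X
  measurable : ∀ j, Measurable (fun q : E × Ξ j => stochGrad F j q.1 q.2)
  grad_integrable : ∀ j X, Integrable (fun ξ => stochGrad F j X ξ) (D j)
  unbiased : ∀ j X, ∫ ξ, stochGrad F j X ξ ∂(D j) = gradient (localLoss D F j) X
  sq_integrable : ∀ j X,
    Integrable (fun ξ => ‖stochGrad F j X ξ - gradient (localLoss D F j) X‖ ^ 2) (D j)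
  variance_le : ∀ j X,
    ∫ ξ, ‖stochGrad F j X ξ - gradient (localLoss D F j) X‖ ^ 2 ∂(D j) ≤ σ ^ 2

end Problem

/-! ### The algorithm -/

section Algorithm

variable {E : Type*} [NormedAddCommGroup E] [InnerProductSpace ℝ E] [CompleteSpace E]
  {n : ℕ} {Ξ : Fin n → Type*} {Ω ΘP ΘD : Type*}

/-- The average `(1/n) ∑_j v_j` over the workers. -/
noncomputable def avg (v : Fin n → E) : E := (1 / (n : ℝ)) • ∑ j, v j

/-- A run of EF21-Muon with momentum `β` and constant stepsize `γ`, i.e. with radii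
`t^k = γ ‖G^k‖_⋆`. The LMO is answered by the oracle `lmo center radius G`. The randomness is
`θP k` (server compressor in round `k`), `θD k` (worker compressors in round `k`; the workers may
use separate coordinates of it, or share it), and `ξ (k + 1) j` (the data sample of worker `j` in
round `k`). -/
structure IsRun (N : Seminorm ℝ E) (F : ∀ j, E → Ξ j → ℝ) (β γ : ℝ)
    (lmo : E → ℝ → E → E) (CP : ℕ → ΘP → E → E) (CD : ℕ → Fin n → ΘD → E → E)
    (θP : ℕ → Ω → ΘP) (θD : ℕ → Ω → ΘD) (ξ : ℕ → ∀ j, Ω → Ξ j)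
    (X₀ : E) (X W : ℕ → Ω → E) (M G : ℕ → Fin n → Ω → E) : Prop where
  X_zero : ∀ ω, X 0 ω = X₀
  W_zero : ∀ ω, W 0 ω = X₀
  X_succ : ∀ k ω, X (k + 1) ω =
    lmo (X k ω) (γ * dualNorm N (avg fun j => G k j ω)) (avg fun j => G k j ω)
  W_succ : ∀ k ω, W (k + 1) ω = W k ω + CP k (θP k ω) (X (k + 1) ω - W k ω)
  M_succ : ∀ k j ω, M (k + 1) j ω =
    (1 - β) • M k j ω + β • stochGrad F j (W (k + 1) ω) (ξ (k + 1) j ω)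
  G_succ : ∀ k j ω, G (k + 1) j ω = G k j ω + CD k j (θD k ω) (M (k + 1) j ω - G k j ω)

/-- Labels of the independent sources of randomness: the initialization, the server compressor and
the worker compressors of each round, and the data sample of each worker in each round. -/
inductive Source (n : ℕ) : Type
  | init : Source n
  | server (k : ℕ) : Source n
  | workers (k : ℕ) : Source n
  | sample (k : ℕ) (j : Fin n) : Source n

/-- The σ-algebra generated by each source of randomness. -/
@[reducible] def sourceSigma [MeasurableSpace E] [MeasurableSpace ΘP] [MeasurableSpace ΘD]
    [∀ j, MeasurableSpace (Ξ j)]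
    (θP : ℕ → Ω → ΘP) (θD : ℕ → Ω → ΘD) (ξ : ℕ → ∀ j, Ω → Ξ j) (M₀ G₀ : Fin n → Ω → E) :
    Source n → MeasurableSpace Ω
  | .init => ⨆ j, (MeasurableSpace.comap (M₀ j) inferInstance ⊔
      MeasurableSpace.comap (G₀ j) inferInstance)
  | .server k => MeasurableSpace.comap (θP k) inferInstance
  | .workers k => MeasurableSpace.comap (θD k) inferInstance
  | .sample k j => MeasurableSpace.comap (ξ (k + 1) j) inferInstance

/-- The probabilistic model: all sources are measurable and mutually independent, the samples
satisfy `ξ_j^{k+1} ∼ D_j`, and the initial momenta and gradient estimators (which may be random and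
need not be independent of each other) have finite second moments. -/
structure IsRandomness [MeasurableSpace E] [MeasurableSpace ΘP] [MeasurableSpace ΘD]
    [∀ j, MeasurableSpace (Ξ j)] [MeasurableSpace Ω] (μ : Measure Ω) (D : ∀ j, Measure (Ξ j))
    (θP : ℕ → Ω → ΘP) (θD : ℕ → Ω → ΘD) (ξ : ℕ → ∀ j, Ω → Ξ j) (M₀ G₀ : Fin n → Ω → E) :
    Prop where
  measurable_server : ∀ k, Measurable (θP k)
  measurable_workers : ∀ k, Measurable (θD k)
  measurable_sample : ∀ k j, Measurable (ξ (k + 1) j)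
  law_sample : ∀ k j, μ.map (ξ (k + 1) j) = D j
  measurable_M₀ : ∀ j, Measurable (M₀ j)
  measurable_G₀ : ∀ j, Measurable (G₀ j)
  memLp_M₀ : ∀ j, MemLp (M₀ j) 2 μ
  memLp_G₀ : ∀ j, MemLp (G₀ j) 2 μ
  independent : iIndep (sourceSigma θP θD ξ M₀ G₀) μ

end Algorithm

/-! ### The constants of the convergence result -/

/-- `L̃ = ((1/n) ∑_j L_j²)^{1/2}`. -/
noncomputable def quadMean {n : ℕ} (Lj : Fin n → ℝ) : ℝ :=
  Real.sqrt ((1 / (n : ℝ)) * ∑ j, Lj j ^ 2)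

/-- The constant `ζ`; the arguments `L`, `Lt` are `L`, `L̃`. -/
noncomputable def zeta (ρlo ρhi αP αD β L Lt : ℝ) : ℝ :=
  ρhi ^ 2 / ρlo ^ 2 *
    (12 / β ^ 2 * L ^ 2 + 24 * (β + 2) / αP ^ 2 * L ^ 2 + 36 * (β ^ 2 + 4) / αD ^ 2 * Lt ^ 2
      + 144 * β ^ 2 * (2 * β + 5) / (αP ^ 2 * αD ^ 2) * Lt ^ 2)

/-- The initial Lyapunov value `Ψ⁰`, for the initial point `X₀`, momenta `M₀ j` and gradient
estimators `G₀ j`. -/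
noncomputable def psiZero {E : Type*} [NormedAddCommGroup E] [InnerProductSpace ℝ E]
    [CompleteSpace E] {n : ℕ} {Ξ : Fin n → Type*} [∀ j, MeasurableSpace (Ξ j)]
    {Ω : Type*} [MeasurableSpace Ω] (μ : Measure Ω)
    (D : ∀ j, Measure (Ξ j)) (F : ∀ j, E → Ξ j → ℝ) (fstar ρhi αD β γ : ℝ)
    (X₀ : E) (M₀ G₀ : Fin n → Ω → E) : ℝ :=
  globalLoss D F X₀ - fstar
    + 6 * ρhi ^ 2 / β * γ * ∫ ω, ‖gradient (globalLoss D F) X₀ - avg (fun j => M₀ j ω)‖ ^ 2 ∂μ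
    + 72 * ρhi ^ 2 * β / αD ^ 2 * γ *
        ((1 / (n : ℝ)) * ∑ j, ∫ ω, ‖gradient (localLoss D F j) X₀ - M₀ j ω‖ ^ 2 ∂μ)
    + 6 * ρhi ^ 2 / αD * γ * ((1 / (n : ℝ)) * ∑ j, ∫ ω, ‖M₀ j ω - G₀ j ω‖ ^ 2 ∂μ)

/-- The prescribed momentum parameter: the minimum of `1` and of the three powers of
`Ψ⁰ L · (n, α_D, α_D²) / (ρlo² σ² K)`. In the noiseless case `σ = 0` the three quotients are read
as `+∞`, so that the minimum is `1`. -/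
noncomputable def momentumChoice (Ψ L ρlo σ αD : ℝ) (n K : ℕ) : ℝ :=
  if σ = 0 then 1 else
    min 1 (min ((Ψ * L * n / (ρlo ^ 2 * σ ^ 2 * K)) ^ (1 / 2 : ℝ))
      (min ((Ψ * L * αD / (ρlo ^ 2 * σ ^ 2 * K)) ^ (1 / 3 : ℝ))
        ((Ψ * L * αD ^ 2 / (ρlo ^ 2 * σ ^ 2 * K)) ^ (1 / 4 : ℝ))))

/-- The four-term convergence rate. -/
noncomputable def rate (Ψ L Lt ρlo ρhi σ αP αD : ℝ) (n K : ℕ) : ℝ :=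
  Ψ * ρhi ^ 2 * Lt / (ρlo ^ 2 * αP * αD * K)
    + (Ψ * ρhi ^ 4 * σ ^ 2 * L / (ρlo ^ 2 * n * K)) ^ (1 / 2 : ℝ)
    + (Ψ * ρhi ^ 3 * σ * L / (ρlo ^ 2 * Real.sqrt αD * K)) ^ (2 / 3 : ℝ)
    + (Ψ * ρlo ^ (8 / 3 : ℝ) * σ ^ (2 / 3 : ℝ) * L
        / (ρhi ^ 2 * αD ^ (2 / 3 : ℝ) * K)) ^ (3 / 4 : ℝ)

end EF21Muon

/-! The oracle realizes the dual norm, so a step of radius $t^k=\gamma\|G^k\|_\star$ decreases $f$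
by a multiple of $\gamma\|\nabla f(X^k)\|_\star^2$, keeps a reserve $(1/(4\gamma)-L/2)(t^k)^2$, and
pays only for $\gamma\|\nabla f(X^k)-G^k\|_\star^2$ (`IsSmooth.lmo_step`). This estimator error
splits into the momentum error $\nabla f(X^k)-\bar M^k$ and the compression errors $M_j^k-G_j^k$.

Each mean-square error contracts up to inputs: the server lag $X^k-W^k$ at rate $\alpha_P/2$, the
momentum errors at rate $\beta$, the compression errors at rate $\alpha_D/2$ (the `_recursion`
lemmas). The inputs are multiples of $\mathbb E(t^k)^2$, of errors earlier in the chain, and of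
$\sigma^2$. The chain is triangular: the lag feeds the momentum errors, and both feed the
compression errors. Summing each recursion over $k$ and substituting therefore bounds everything by
initial errors, noise, and a multiple of $\sum_k\mathbb E(t^k)^2$; the stepsize is such that the
reserve absorbs this multiple (`sum_gradient_le`, `stepsize_condition`).

The gradient noise of a round is centred given all earlier draws, hence orthogonal in $L^2$ to the
drift, and it enters as $\beta^2\sigma^2$, or $\beta^2\sigma^2/n$ after averaging over workers.
Conditioning is done by Fubini: a source of randomness is independent of whatever is measurable with
respect to the other sources.

For the rate, the term $\Psi^0L/(\beta K)$ competes with noise terms of order $\beta/n$,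
$\beta^2/\alpha_D$, $\beta^3/\alpha_D^2$. Unless $\beta=1$, one entry of the minimum defining
$\beta$ is attained, and there the first quantity equals one of the noise terms (`le_rate`). -/

namespace EF21Muon

/-! ### Dual norm and linear minimization oracle -/

section DualNorm

variable {E : Type*} [NormedAddCommGroup E] [InnerProductSpace ℝ E] {N : Seminorm ℝ E}
  {ρlo ρhi : ℝ}

theorem NormEquivalence.inner_le (h : NormEquivalence N ρlo ρhi) {G Z : E} (hZ : N Z ≤ 1) :
    inner ℝ G Z ≤ ρhi * ‖G‖ := by
  have h1 := real_inner_le_norm G Z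
  have h2 := h.upper Z
  have h3 : ‖Z‖ ≤ ρhi := h2.trans (by nlinarith [h.hi_pos])
  nlinarith [norm_nonneg G]

theorem NormEquivalence.bddAbove (h : NormEquivalence N ρlo ρhi) (G : E) :
    BddAbove ((fun Z : E => inner ℝ G Z) '' {Z : E | N Z ≤ 1}) := by
  refine ⟨ρhi * ‖G‖, ?_⟩
  rintro _ ⟨Z, hZ, rfl⟩
  exact h.inner_le hZ

theorem NormEquivalence.inner_le_dualNorm (h : NormEquivalence N ρlo ρhi) {G Z : E}
    (hZ : N Z ≤ 1) : inner ℝ G Z ≤ dualNorm N G :=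
  le_csSup (h.bddAbove G) ⟨Z, hZ, rfl⟩

theorem dualNorm_le {G : E} {c : ℝ} (hc : ∀ Z, N Z ≤ 1 → inner ℝ G Z ≤ c) :
    dualNorm N G ≤ c := by
  refine csSup_le ⟨_, 0, by simp, rfl⟩ ?_
  rintro _ ⟨Z, hZ, rfl⟩
  exact hc Z hZ

theorem NormEquivalence.dualNorm_nonneg (h : NormEquivalence N ρlo ρhi) (G : E) :
    0 ≤ dualNorm N G := by
  simpa using h.inner_le_dualNorm (G := G) (Z := 0) (by simp)

theorem NormEquivalence.dualNorm_le_norm (h : NormEquivalence N ρlo ρhi) (G : E) :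
    dualNorm N G ≤ ρhi * ‖G‖ :=
  dualNorm_le fun _ hZ => h.inner_le hZ

theorem NormEquivalence.inner_le_mul (h : NormEquivalence N ρlo ρhi) (G Z : E) :
    inner ℝ G Z ≤ dualNorm N G * N Z := by
  rcases (apply_nonneg N Z).eq_or_lt with h0 | h0
  · have : Z = 0 := by
      have := h.upper Z
      rw [← h0, mul_zero] at this
      exact norm_le_zero_iff.1 this
    simp [this]
  · have h1 : N ((N Z)⁻¹ • Z) ≤ 1 := by
      rw [map_smul_eq_mul, Real.norm_of_nonneg (by positivity), inv_mul_cancel₀ h0.ne']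
    have h2 := h.inner_le_dualNorm (G := G) h1
    rw [inner_smul_right, inv_mul_le_iff₀ h0] at h2
    linarith

/-- Pair `G` with itself: $\|G\|_2^2\le\|G\|_\star N(G)$, and $N(G)\le\|G\|_2/\underline\rho$. -/
theorem NormEquivalence.norm_le_dualNorm (h : NormEquivalence N ρlo ρhi) (G : E) :
    ρlo * ‖G‖ ≤ dualNorm N G := by
  rcases (norm_nonneg G).eq_or_lt with h0 | h0
  · rw [← h0, mul_zero]
    exact h.dualNorm_nonneg G
  · have h1 := h.inner_le_mul G G
    rw [real_inner_self_eq_norm_sq] at h1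
    have h2 := h.lower G
    have h3 := h.dualNorm_nonneg G
    have h4 := h.lo_pos
    have h5 : ρlo * ‖G‖ ^ 2 ≤ dualNorm N G * ‖G‖ := by
      nlinarith
    nlinarith

theorem NormEquivalence.dualNorm_add_le (h : NormEquivalence N ρlo ρhi) (a b : E) :
    dualNorm N (a + b) ≤ dualNorm N a + dualNorm N b :=
  dualNorm_le fun Z hZ => by
    rw [inner_add_left]
    exact add_le_add (h.inner_le_dualNorm hZ) (h.inner_le_dualNorm hZ)

theorem NormEquivalence.lipschitzWith_dualNorm (h : NormEquivalence N ρlo ρhi) :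
    LipschitzWith ρhi.toNNReal (dualNorm N) := by
  refine LipschitzWith.of_le_add_mul' _ fun a b => ?_
  have h1 := h.dualNorm_add_le b (a - b)
  rw [add_sub_cancel] at h1
  rw [dist_eq_norm]
  linarith [h.dualNorm_le_norm (a - b)]

theorem NormEquivalence.lipschitzWith (h : NormEquivalence N ρlo ρhi) :
    LipschitzWith (ρlo⁻¹).toNNReal N := by
  refine LipschitzWith.of_le_add_mul' _ fun a b => ?_
  have h1 := map_add_le_add N b (a - b)
  rw [add_sub_cancel] at h1
  have h2 : N (a - b) ≤ ρlo⁻¹ * ‖a - b‖ := by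
    rw [inv_mul_eq_div, le_div_iff₀' h.lo_pos]
    exact h.lower _
  rw [dist_eq_norm]
  linarith

/-- Needed only for $\bar\rho^2/\underline\rho^2\ge1$ in the bound on $\gamma^{-1}$. It fails on the
zero space, where the constants are unrelated. -/
theorem NormEquivalence.lo_le_hi [Nontrivial E] (h : NormEquivalence N ρlo ρhi) : ρlo ≤ ρhi := by
  obtain ⟨x, hx⟩ := exists_ne (0 : E)
  have h1 := h.lower x
  have h2 := h.upper x
  have h3 : 0 < ‖x‖ := norm_pos_iff.2 hx
  have h4 : 0 < N x := by
    by_contra h5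
    nlinarith [h.hi_pos]
  nlinarith

/-- The value of the linear minimization oracle. -/
theorem IsLMO.inner_le {c G Z : E} {t : ℝ}
    (ht : 0 ≤ t) (hZ : IsLMO N c t G Z) : t * dualNorm N G ≤ - inner ℝ G (Z - c) := by
  rcases ht.eq_or_lt with h0 | h0
  · have := hZ.2 c (by simpa using ht)
    rw [inner_sub_right, ← h0]
    linarith
  · rw [← le_div_iff₀' h0]
    refine dualNorm_le fun Y hY => ?_
    rw [le_div_iff₀' h0]
    -- Every `Y` in the unit ball gives the feasible competitor `c - t • Y`.
    have := hZ.2 (c - t • Y) (by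
      rw [sub_sub_cancel_left, map_neg_eq_map, map_smul_eq_mul, Real.norm_of_nonneg ht]
      nlinarith)
    rw [inner_sub_right, inner_smul_right] at this
    rw [inner_sub_right]
    linarith

end DualNorm

/-! ### Smoothness and one-step descent -/

section Smooth

variable {E : Type*} [NormedAddCommGroup E] [InnerProductSpace ℝ E] [CompleteSpace E]
  {N : Seminorm ℝ E} {ρlo ρhi L : ℝ} {f : E → ℝ}

theorem IsSmooth.norm_gradient_sub_le (hN : NormEquivalence N ρlo ρhi) (hf : IsSmooth N L f)
    (X Y : E) : ‖gradient f X - gradient f Y‖ ≤ L / ρlo * N (X - Y) := by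
  have h1 := hN.norm_le_dualNorm (gradient f X - gradient f Y)
  have h2 := hf.lipschitz X Y
  rw [div_mul_eq_mul_div, le_div_iff₀' hN.lo_pos]
  linarith

theorem IsSmooth.norm_gradient_sub_sq_le (hN : NormEquivalence N ρlo ρhi) (hf : IsSmooth N L f)
    (X Y : E) : ‖gradient f X - gradient f Y‖ ^ 2 ≤ L ^ 2 / ρlo ^ 2 * N (X - Y) ^ 2 := by
  rw [← div_pow, ← mul_pow]
  exact pow_le_pow_left₀ (norm_nonneg _) (hf.norm_gradient_sub_le hN X Y) 2

theorem IsSmooth.lipschitzWith_gradient (hN : NormEquivalence N ρlo ρhi) (hf : IsSmooth N L f) :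
    LipschitzWith (L / ρlo * ρlo⁻¹).toNNReal (gradient f) := by
  have h0 : 0 ≤ L / ρlo := div_nonneg hf.nonneg hN.lo_pos.le
  refine LipschitzWith.of_dist_le_mul fun X Y => ?_
  rw [dist_eq_norm, dist_eq_norm, Real.coe_toNNReal _ (mul_nonneg h0 (inv_nonneg.2 hN.lo_pos.le))]
  refine (hf.norm_gradient_sub_le hN X Y).trans ?_
  rw [mul_assoc]
  refine mul_le_mul_of_nonneg_left ?_ h0
  rw [inv_mul_eq_div, le_div_iff₀' hN.lo_pos]
  exact hN.lower _

/-- Along the segment, $f$ minus the claimed quadratic upper model has nonpositive derivative, by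
duality and the Lipschitz bound; compare the endpoints $s=0$ and $s=1$. -/
theorem IsSmooth.descent (hN : NormEquivalence N ρlo ρhi) (hf : IsSmooth N L f) (X V : E) :
    f (X + V) ≤ f X + inner ℝ (gradient f X) V + L / 2 * N V ^ 2 := by
  have hd : ∀ s : ℝ, HasDerivAt
      (fun s : ℝ => f (X + s • V) - s * inner ℝ (gradient f X) V - L / 2 * N V ^ 2 * s ^ 2)
      (inner ℝ (gradient f (X + s • V)) V - inner ℝ (gradient f X) V - L * N V ^ 2 * s) s := by
    intro s
    have h1 : HasDerivAt (fun s : ℝ => X + s • V) V s := by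
      simpa using ((hasDerivAt_id s).smul_const V).const_add X
    have h2 := (hf.differentiable (X + s • V)).hasGradientAt.hasFDerivAt.comp_hasDerivAt s h1
    have h3 := (h2.sub ((hasDerivAt_id s).mul_const (inner ℝ (gradient f X) V))).sub
      ((hasDerivAt_pow 2 s).const_mul (L / 2 * N V ^ 2))
    refine h3.congr_deriv ?_
    rw [InnerProductSpace.toDual_apply_apply]
    simp
    ring
  have hanti : AntitoneOn
      (fun s : ℝ => f (X + s • V) - s * inner ℝ (gradient f X) V - L / 2 * N V ^ 2 * s ^ 2)
      (Set.Icc 0 1) := by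
    refine antitoneOn_of_deriv_nonpos (convex_Icc 0 1)
      (fun s _ => (hd s).continuousAt.continuousWithinAt)
      (fun s _ => (hd s).differentiableAt.differentiableWithinAt) fun s hs => ?_
    rw [interior_Icc] at hs
    rw [(hd s).deriv, ← inner_sub_left]
    have h1 := hN.inner_le_mul (gradient f (X + s • V) - gradient f X) V
    have h2 := hf.lipschitz (X + s • V) X
    rw [add_sub_cancel_left, map_smul_eq_mul, Real.norm_of_nonneg hs.1.le] at h2
    nlinarith [apply_nonneg N V]
  have := hanti (Set.left_mem_Icc.2 zero_le_one) (Set.right_mem_Icc.2 zero_le_one) zero_le_one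
  simp only [one_smul, zero_smul, add_zero, one_mul, zero_mul, one_pow, mul_one, sub_zero,
    ne_eq, OfNat.ofNat_ne_zero, not_false_eq_true, zero_pow, mul_zero] at this
  linarith

/-- With $g=\|G\|_\star$ and $e=\|\nabla f(X)-G\|_\star$, the linear term of the descent inequality
is at most $\gamma(eg-g^2)$. Of the gain $\gamma g^2$, a quarter is kept as the reserve
$t^2/(4\gamma)$; the rest pays for $eg$ and for the gradient term, through $\|\nabla f(X)\|_\star\le
e+g$. -/
theorem IsSmooth.lmo_step (hN : NormEquivalence N ρlo ρhi) (hf : IsSmooth N L f) {X Z G : E}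
    {γ : ℝ} (hγ : 0 < γ) (hZ : IsLMO N X (γ * dualNorm N G) G Z) :
    f Z + γ / 8 * dualNorm N (gradient f X) ^ 2 + (1 / (4 * γ) - L / 2) *
      (γ * dualNorm N G) ^ 2 ≤ f X + 3 / 4 * γ * dualNorm N (gradient f X - G) ^ 2 := by
  have hg := hN.dualNorm_nonneg G
  have he := hN.dualNorm_nonneg (gradient f X - G)
  have hd := hN.dualNorm_nonneg (gradient f X)
  have h1 := hf.descent hN X (Z - X)
  have h2 := hZ.inner_le (mul_nonneg hγ.le hg)
  have h3 := hN.inner_le_mul (gradient f X - G) (Z - X)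
  have h4 := hN.dualNorm_add_le (gradient f X - G) G
  rw [sub_add_cancel] at h4
  rw [inner_sub_left] at h3
  rw [add_sub_cancel] at h1
  have h5 : N (Z - X) ^ 2 ≤ (γ * dualNorm N G) ^ 2 := pow_le_pow_left₀ (apply_nonneg _ _) hZ.1 2
  have h6 : dualNorm N (gradient f X - G) * N (Z - X) ≤
      dualNorm N (gradient f X - G) * (γ * dualNorm N G) := mul_le_mul_of_nonneg_left hZ.1 he
  have h7 := mul_le_mul_of_nonneg_left h5 (div_nonneg hf.nonneg zero_le_two)
  have h8 : (1 / (4 * γ) - L / 2) * (γ * dualNorm N G) ^ 2 =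
      γ / 4 * dualNorm N G ^ 2 - L / 2 * (γ * dualNorm N G) ^ 2 := by
    field_simp
  rw [h8]
  generalize dualNorm N (gradient f X - G) = e at *
  generalize dualNorm N (gradient f X) = d at *
  generalize dualNorm N G = g at *
  have h9 : d ^ 2 ≤ 2 * g ^ 2 + 2 * e ^ 2 := by nlinarith [sq_nonneg (e - g)]
  have h10 : γ * (d ^ 2 / 8 + g ^ 2 / 4 + e * g) ≤ γ * (g ^ 2 + 3 / 4 * e ^ 2) :=
    mul_le_mul_of_nonneg_left (by nlinarith [sq_nonneg (e - g)]) hγ.le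
  nlinarith

/-- With $L=0$ the descent inequality is linear, so a nonzero gradient would take $f$ below any
bound. This settles the degenerate case $\gamma=0$. -/
theorem IsSmooth.gradient_eq_zero (hN : NormEquivalence N ρlo ρhi) (hf : IsSmooth N 0 f)
    {c : ℝ} (hc : ∀ X, c ≤ f X) (X : E) : gradient f X = 0 := by
  by_contra h
  have h0 : 0 < ‖gradient f X‖ ^ 2 := by positivity
  -- The step length is chosen so that the linear model lands at `c - 1`.
  have h1 := hf.descent hN X (-((f X - c + 1) / ‖gradient f X‖ ^ 2) • gradient f X)
  rw [inner_smul_right, real_inner_self_eq_norm_sq, neg_mul, div_mul_cancel₀ _ h0.ne'] at h1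
  linarith [hc (X + -((f X - c + 1) / ‖gradient f X‖ ^ 2) • gradient f X)]

end Smooth

/-! ### Averages over the workers -/

section Loss

variable {E : Type*} [NormedAddCommGroup E] [InnerProductSpace ℝ E] [CompleteSpace E]
  {n : ℕ} {Ξ : Fin n → Type*} [∀ j, MeasurableSpace (Ξ j)]

theorem gradient_globalLoss {D : ∀ j, Measure (Ξ j)} {F : ∀ j, E → Ξ j → ℝ}
    (h : ∀ j, Differentiable ℝ (localLoss D F j)) (X : E) :
    gradient (globalLoss D F) X = avg fun j => gradient (localLoss D F j) X := by
  have h1 : HasFDerivAt (globalLoss D F)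
      ((1 / (n : ℝ)) • ∑ j, fderiv ℝ (localLoss D F j) X) X :=
    (HasFDerivAt.fun_sum fun j _ => (h j X).hasFDerivAt).const_mul (1 / (n : ℝ))
  simp only [gradient, h1.fderiv, avg, map_smulₛₗ, map_sum]
  simp

omit [CompleteSpace E] in
theorem norm_avg_sq_le (v : Fin n → E) : ‖avg v‖ ^ 2 ≤ 1 / (n : ℝ) * ∑ j, ‖v j‖ ^ 2 := by
  rcases n.eq_zero_or_pos with h0 | h0
  · subst h0
    simp [avg]
  have h1 : ‖∑ j, v j‖ ^ 2 ≤ (n : ℝ) * ∑ j, ‖v j‖ ^ 2 := by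
    refine (pow_le_pow_left₀ (norm_nonneg _) (norm_sum_le _ _) 2).trans ?_
    simpa using sq_sum_le_card_mul_sum_sq (s := Finset.univ) (f := fun j => ‖v j‖)
  have hn : (0 : ℝ) < n := by exact_mod_cast h0
  rw [avg, norm_smul, mul_pow, Real.norm_of_nonneg (by positivity)]
  calc (1 / (n : ℝ)) ^ 2 * ‖∑ j, v j‖ ^ 2 ≤ (1 / (n : ℝ)) ^ 2 * ((n : ℝ) * ∑ j, ‖v j‖ ^ 2) := by
        gcongr
    _ = _ := by field_simp

omit [CompleteSpace E] in
theorem avg_sub (v w : Fin n → E) : avg (fun j => v j - w j) = avg v - avg w := by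
  simp [avg, Finset.sum_sub_distrib, smul_sub]

omit [CompleteSpace E] in
theorem avg_add (v w : Fin n → E) : avg (fun j => v j + w j) = avg v + avg w := by
  simp [avg, Finset.sum_add_distrib, smul_add]

omit [CompleteSpace E] in
theorem avg_smul (c : ℝ) (v : Fin n → E) : avg (fun j => c • v j) = c • avg v := by
  simp [avg, ← Finset.smul_sum, smul_comm c]

end Loss

/-! ### Young-type inequalities -/

section Inequalities

variable {E : Type*} [NormedAddCommGroup E] [InnerProductSpace ℝ E]

theorem Seminorm.add_sq_le (p : Seminorm ℝ E) {c : ℝ} (hc : 0 < c) (x y : E) :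
    p (x + y) ^ 2 ≤ (1 + c) * p x ^ 2 + (1 + c⁻¹) * p y ^ 2 := by
  have h1 : p (x + y) ^ 2 ≤ (p x + p y) ^ 2 :=
    pow_le_pow_left₀ (apply_nonneg _ _) (map_add_le_add p x y) 2
  have h2 : 0 ≤ c⁻¹ * (c * p x - p y) ^ 2 := by positivity
  have h3 : c⁻¹ * (c * p x - p y) ^ 2 = c * p x ^ 2 - 2 * (p x * p y) + c⁻¹ * p y ^ 2 := by
    field_simp
    ring
  nlinarith

/-- Young's inequality with parameter $\alpha/2$ spends half of the contraction:
$(1-\alpha)(1+\alpha/2)\le1-\alpha/2$ and $(1-\alpha)(1+2/\alpha)\le2/\alpha$. -/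
theorem contract_add_sq_le (p : Seminorm ℝ E) {α : ℝ} (h0 : 0 < α) (h1 : α ≤ 1) (x y : E) :
    (1 - α) * p (x + y) ^ 2 ≤ (1 - α / 2) * p x ^ 2 + 2 / α * p y ^ 2 := by
  have h2 := mul_le_mul_of_nonneg_left (Seminorm.add_sq_le p (half_pos h0) x y) (sub_nonneg.2 h1)
  refine h2.trans ?_
  have h3 : (1 - α) * (1 + (α / 2)⁻¹) ≤ 2 / α := by
    rw [le_div_iff₀ h0]
    field_simp
    nlinarith
  have h4 : (1 - α) * (1 + α / 2) ≤ 1 - α / 2 := by nlinarith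
  nlinarith [sq_nonneg (p x), sq_nonneg (p y), mul_le_mul_of_nonneg_right h3 (sq_nonneg (p y)),
    mul_le_mul_of_nonneg_right h4 (sq_nonneg (p x))]

omit [InnerProductSpace ℝ E] in
theorem norm_add_three_sq_le (x y z : E) :
    ‖x + y + z‖ ^ 2 ≤ 3 * (‖x‖ ^ 2 + ‖y‖ ^ 2 + ‖z‖ ^ 2) := by
  have h1 : ‖x + y + z‖ ^ 2 ≤ (‖x‖ + ‖y‖ + ‖z‖) ^ 2 :=
    pow_le_pow_left₀ (norm_nonneg _) (norm_add₃_le) 2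
  nlinarith [sq_nonneg (‖x‖ - ‖y‖), sq_nonneg (‖y‖ - ‖z‖), sq_nonneg (‖x‖ - ‖z‖)]

/-- Convexity of the square with weights $1-\beta$ and $\beta$: the drift `y` is put into the second
slot as $\beta\cdot(y/\beta)$, so its coefficient is $2\beta/\beta^2=2/\beta$. -/
theorem momentum_sq_le {β : ℝ} (h0 : 0 < β) (h1 : β ≤ 1) (x y z : E) :
    ‖(1 - β) • x + (1 - β) • y + β • z‖ ^ 2 ≤
      (1 - β) * ‖x‖ ^ 2 + 2 / β * ‖y‖ ^ 2 + 2 * β * ‖z‖ ^ 2 := by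
  have h2 : ‖(1 - β) • x + (1 - β) • y + β • z‖ ≤ (1 - β) * ‖x‖ + ((1 - β) * ‖y‖ + β * ‖z‖) := by
    refine (norm_add₃_le).trans_eq ?_
    rw [norm_smul, norm_smul, norm_smul, Real.norm_of_nonneg h0.le,
      Real.norm_of_nonneg (sub_nonneg.2 h1), add_assoc]
  refine (pow_le_pow_left₀ (norm_nonneg _) h2 2).trans ?_
  generalize ‖x‖ = a, ‖y‖ = b, ‖z‖ = c
  have h3 : 2 / β * b ^ 2 = 2 * β * (b / β) ^ 2 := by field_simp
  rw [h3]
  obtain ⟨u, rfl⟩ : ∃ u, b = β * u := ⟨b / β, by field_simp⟩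
  rw [mul_div_cancel_left₀ _ h0.ne']
  have h4 : ((1 - β) * a + ((1 - β) * (β * u) + β * c)) ^ 2 ≤
      (1 - β) * a ^ 2 + β * ((1 - β) * u + c) ^ 2 := by
    nlinarith [mul_nonneg (mul_nonneg h0.le (sub_nonneg.2 h1)) (sq_nonneg (a - ((1 - β) * u + c)))]
  have h5 : ((1 - β) * u + c) ^ 2 ≤ 2 * u ^ 2 + 2 * c ^ 2 := by
    nlinarith [sq_nonneg ((1 - β) * u - c), mul_nonneg (mul_nonneg h0.le (by linarith : 0 ≤ 2 - β)) (sq_nonneg u)]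
  nlinarith

end Inequalities

theorem integrable_inner_of_memLp {Ω E : Type*} [MeasurableSpace Ω] {μ : Measure Ω}
    [NormedAddCommGroup E] [InnerProductSpace ℝ E] {A Z : Ω → E} (hA : MemLp A 2 μ)
    (hZ : MemLp Z 2 μ) : Integrable (fun ω => inner ℝ (A ω) (Z ω)) μ :=
  (hA.norm.integrable_mul hZ.norm).mono (hA.1.inner hZ.1)
    (ae_of_all _ fun ω => by simpa using norm_inner_le_norm (𝕜 := ℝ) (A ω) (Z ω))

/-! ### Integrating out an independent source -/

section Independence

variable {Ω S T E : Type*} [MeasurableSpace Ω] [MeasurableSpace S] [MeasurableSpace T]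
  {μ : Measure Ω} [IsProbabilityMeasure μ] {Y : Ω → S} {Z : Ω → T}

theorem lintegral_comp_indepFun (hY : Measurable Y) (hZ : Measurable Z) (hYZ : IndepFun Y Z μ)
    {h : S × T → ENNReal} (hh : Measurable h) :
    ∫⁻ ω, h (Y ω, Z ω) ∂μ = ∫⁻ ω, ∫⁻ z, h (Y ω, z) ∂(μ.map Z) ∂μ := by
  have := Measure.isProbabilityMeasure_map (μ := μ) hZ.aemeasurable
  have h1 := (indepFun_iff_map_prod_eq_prod_map_map hY.aemeasurable hZ.aemeasurable).1 hYZ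
  rw [← lintegral_map hh (hY.prodMk hZ), h1, lintegral_prod _ hh.aemeasurable,
    lintegral_map hh.lintegral_prod_right' hY]

/-- Stands in for conditioning on `Y`: a bound for each frozen value `y` integrates to a bound for
the pair. Working with lower integrals yields integrability along with the estimate. -/
theorem integrable_comp_indepFun (hY : Measurable Y) (hZ : Measurable Z) (hYZ : IndepFun Y Z μ)
    {h : S × T → ℝ} (hh : Measurable h) (h0 : ∀ q, 0 ≤ h q)
    (hi : ∀ y, Integrable (fun z => h (y, z)) (μ.map Z)) {g : S → ℝ}
    (hg : ∀ y, ∫ z, h (y, z) ∂(μ.map Z) ≤ g y) (hgi : Integrable (fun ω => g (Y ω)) μ) :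
    Integrable (fun ω => h (Y ω, Z ω)) μ ∧ ∫ ω, h (Y ω, Z ω) ∂μ ≤ ∫ ω, g (Y ω) ∂μ := by
  have hg0 : ∀ y, 0 ≤ g y := fun y => (integral_nonneg fun z => h0 (y, z)).trans (hg y)
  have key : ∫⁻ ω, ENNReal.ofReal (h (Y ω, Z ω)) ∂μ ≤ ENNReal.ofReal (∫ ω, g (Y ω) ∂μ) := by
    rw [lintegral_comp_indepFun hY hZ hYZ (h := fun q => ENNReal.ofReal (h q)) hh.ennreal_ofReal,
      ofReal_integral_eq_lintegral_ofReal hgi (ae_of_all _ fun ω => hg0 _)]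
    refine lintegral_mono fun ω => ?_
    rw [← ofReal_integral_eq_lintegral_ofReal (hi _) (ae_of_all _ fun z => h0 _)]
    exact ENNReal.ofReal_le_ofReal (hg _)
  have hm : AEStronglyMeasurable (fun ω => h (Y ω, Z ω)) μ :=
    (hh.comp (hY.prodMk hZ)).aestronglyMeasurable
  refine ⟨⟨hm, ?_⟩, ?_⟩
  · rw [hasFiniteIntegral_iff_ofReal (ae_of_all _ fun ω => h0 _)]
    exact key.trans_lt ENNReal.ofReal_lt_top
  · rw [integral_eq_lintegral_of_nonneg_ae (ae_of_all _ fun ω => h0 _) hm]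
    exact ENNReal.toReal_le_of_le_ofReal (integral_nonneg fun ω => hg0 _) key

variable [NormedAddCommGroup E] [InnerProductSpace ℝ E] [CompleteSpace E] [MeasurableSpace E]
  [BorelSpace E] [SecondCountableTopology E]

/-- A variable with conditional mean zero given `Y` is orthogonal to every square-integrable
function of `Y`; by Fubini the inner integral over `z` vanishes. -/
theorem integral_inner_indepFun_eq_zero (hY : Measurable Y) (hZ : Measurable Z)
    (hYZ : IndepFun Y Z μ) {A : S → E} (hA : Measurable A) {φ : S × T → E} (hφ : Measurable φ)
    (hi : ∀ y, Integrable (fun z => φ (y, z)) (μ.map Z)) (h0 : ∀ y, ∫ z, φ (y, z) ∂(μ.map Z) = 0)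
    (hAY : MemLp (fun ω => A (Y ω)) 2 μ) (hφY : MemLp (fun ω => φ (Y ω, Z ω)) 2 μ) :
    ∫ ω, inner ℝ (A (Y ω)) (φ (Y ω, Z ω)) ∂μ = 0 := by
  have := Measure.isProbabilityMeasure_map (μ := μ) hZ.aemeasurable
  have := Measure.isProbabilityMeasure_map (μ := μ) hY.aemeasurable
  have h1 := (indepFun_iff_map_prod_eq_prod_map_map hY.aemeasurable hZ.aemeasurable).1 hYZ
  have hm : Measurable fun q : S × T => inner ℝ (A q.1) (φ q) := (hA.comp measurable_fst).inner hφ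
  have hint : Integrable (fun ω => inner ℝ (A (Y ω)) (φ (Y ω, Z ω))) μ := integrable_inner_of_memLp hAY hφY
  have hint' : Integrable (fun q : S × T => inner ℝ (A q.1) (φ q))
      ((μ.map Y).prod (μ.map Z)) := by
    rw [← h1]
    exact (integrable_map_measure hm.aestronglyMeasurable (hY.prodMk hZ).aemeasurable).2 hint
  rw [← integral_map (φ := fun ω => (Y ω, Z ω)) (f := fun q : S × T => inner ℝ (A q.1) (φ q))
    (hY.prodMk hZ).aemeasurable hm.aestronglyMeasurable, h1, integral_prod _ hint']
  simp only [integral_inner (hi _), h0, inner_zero_right, integral_zero]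

end Independence

/-! ### Orthogonality and second moments -/

section SecondMoment

variable {Ω E : Type*} [MeasurableSpace Ω] {μ : Measure Ω} [NormedAddCommGroup E]
  [InnerProductSpace ℝ E]

theorem integral_norm_add_sq {A Z : Ω → E} (hA : MemLp A 2 μ) (hZ : MemLp Z 2 μ)
    (h0 : ∫ ω, inner ℝ (A ω) (Z ω) ∂μ = 0) :
    ∫ ω, ‖A ω + Z ω‖ ^ 2 ∂μ = ∫ ω, ‖A ω‖ ^ 2 ∂μ + ∫ ω, ‖Z ω‖ ^ 2 ∂μ := by
  have h1 : Integrable (fun ω => ‖A ω‖ ^ 2) μ := hA.integrable_norm_pow (by norm_num)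
  have h2 : Integrable (fun ω => ‖Z ω‖ ^ 2) μ := hZ.integrable_norm_pow (by norm_num)
  have h3 : Integrable (fun ω => 2 * inner ℝ (A ω) (Z ω)) μ :=
    (integrable_inner_of_memLp hA hZ).const_mul 2
  simp only [norm_add_sq_real]
  rw [integral_add (f := fun ω => ‖A ω‖ ^ 2 + 2 * inner ℝ (A ω) (Z ω)) (h1.add h3) h2,
    integral_add h1 h3, integral_const_mul, h0]
  simp

theorem integral_norm_add_smul_sq {A Z : Ω → E} (hA : MemLp A 2 μ) (hZ : MemLp Z 2 μ)
    (h0 : ∫ ω, inner ℝ (A ω) (Z ω) ∂μ = 0) (c : ℝ) :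
    ∫ ω, ‖A ω + c • Z ω‖ ^ 2 ∂μ = ∫ ω, ‖A ω‖ ^ 2 ∂μ + c ^ 2 * ∫ ω, ‖Z ω‖ ^ 2 ∂μ := by
  have h1 := integral_norm_add_sq hA (hZ.const_smul c) (by
    simp only [Pi.smul_apply, inner_smul_right, integral_const_mul, h0, mul_zero])
  simpa only [Pi.smul_apply, norm_smul, mul_pow, integral_const_mul, Real.norm_eq_abs,
    sq_abs] using h1

theorem integral_inner_avg_eq_zero {n : ℕ} {A : Ω → E} {Z : Fin n → Ω → E} (hA : MemLp A 2 μ)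
    (hZ : ∀ j, MemLp (Z j) 2 μ) (h0 : ∀ j, ∫ ω, inner ℝ (A ω) (Z j ω) ∂μ = 0) :
    ∫ ω, inner ℝ (A ω) (avg fun j => Z j ω) ∂μ = 0 := by
  simp only [avg, inner_smul_right, inner_sum]
  rw [integral_const_mul, integral_finsetSum _ fun j _ => integrable_inner_of_memLp hA (hZ j),
    Finset.sum_eq_zero fun j _ => h0 j, mul_zero]

/-- Only the $n$ diagonal terms of the expanded square survive, against the prefactor $1/n^2$: this
is the source of the $1/n$ variance reduction. -/
theorem integral_norm_avg_sq_le {n : ℕ} (hn : 0 < n) {Z : Fin n → Ω → E}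
    (hZ : ∀ j, MemLp (Z j) 2 μ)
    (h0 : ∀ i j, i ≠ j → ∫ ω, inner ℝ (Z i ω) (Z j ω) ∂μ = 0) {c : ℝ}
    (hc : ∀ j, ∫ ω, ‖Z j ω‖ ^ 2 ∂μ ≤ c) :
    ∫ ω, ‖avg fun j => Z j ω‖ ^ 2 ∂μ ≤ c / n := by
  have hn' : (0 : ℝ) < n := by exact_mod_cast hn
  have h1 : ∀ ω, ‖avg fun j => Z j ω‖ ^ 2 =
      (1 / (n : ℝ)) ^ 2 * ∑ i, ∑ j, inner ℝ (Z i ω) (Z j ω) := by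
    intro ω
    rw [avg, norm_smul, mul_pow, Real.norm_of_nonneg (by positivity),
      ← real_inner_self_eq_norm_sq, sum_inner]
    simp_rw [inner_sum]
  have hi : ∀ i j, Integrable (fun ω => inner ℝ (Z i ω) (Z j ω)) μ :=
    fun i j => integrable_inner_of_memLp (hZ i) (hZ j)
  simp_rw [h1]
  rw [integral_const_mul, integral_finsetSum _ fun i _ => integrable_finsetSum _ fun j _ => hi i j]
  have h2 : ∀ i, ∫ ω, ∑ j, inner ℝ (Z i ω) (Z j ω) ∂μ ≤ c := by
    intro i
    rw [integral_finsetSum _ fun j _ => hi i j, Finset.sum_eq_single i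
      (fun j _ hj => h0 i j hj.symm) (by simp)]
    simpa only [real_inner_self_eq_norm_sq] using hc i
  calc (1 / (n : ℝ)) ^ 2 * ∑ i, ∫ ω, ∑ j, inner ℝ (Z i ω) (Z j ω) ∂μ
      ≤ (1 / (n : ℝ)) ^ 2 * ∑ i : Fin n, c := by
        gcongr with i
        exact h2 i
    _ = c / n := by
        simp
        field_simp

end SecondMoment

/-! ### Order of the draws and the generated σ-algebras -/

section Sources

variable {E : Type*} [MeasurableSpace E] [NormedAddCommGroup E]
  {n : ℕ} {Ξ : Fin n → Type*} [∀ j, MeasurableSpace (Ξ j)]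
  {Ω ΘP ΘD : Type*} [mΩ : MeasurableSpace Ω] [MeasurableSpace ΘP] [MeasurableSpace ΘD]

/-- The position of a source of randomness in the order in which the algorithm draws them. -/
def Source.time : Source n → ℕ
  | .init => 0
  | .server k => 3 * k + 1
  | .sample k _ => 3 * k + 2
  | .workers k => 3 * k + 3

/-- The σ-algebra generated by the sources of randomness in `S`. -/
@[reducible] def sigmaOf (θP : ℕ → Ω → ΘP) (θD : ℕ → Ω → ΘD) (ξ : ℕ → ∀ j, Ω → Ξ j)
    (M₀ G₀ : Fin n → Ω → E) (S : Set (Source n)) : MeasurableSpace Ω :=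
  ⨆ s ∈ S, sourceSigma θP θD ξ M₀ G₀ s

variable {μ : Measure Ω} {D : ∀ j, Measure (Ξ j)} {θP : ℕ → Ω → ΘP} {θD : ℕ → Ω → ΘD}
  {ξ : ℕ → ∀ j, Ω → Ξ j} {M₀ G₀ : Fin n → Ω → E}

omit [NormedAddCommGroup E] mΩ in
theorem sigmaOf_mono {S S' : Set (Source n)} (h : S ⊆ S') :
    sigmaOf θP θD ξ M₀ G₀ S ≤ sigmaOf θP θD ξ M₀ G₀ S' :=
  biSup_mono h

omit [NormedAddCommGroup E] mΩ in
theorem sourceSigma_le_sigmaOf {S : Set (Source n)} {s : Source n} (h : s ∈ S) :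
    sourceSigma θP θD ξ M₀ G₀ s ≤ sigmaOf θP θD ξ M₀ G₀ S :=
  le_biSup (sourceSigma θP θD ξ M₀ G₀) h

theorem IsRandomness.sourceSigma_le (h : IsRandomness μ D θP θD ξ M₀ G₀) (s : Source n) :
    sourceSigma θP θD ξ M₀ G₀ s ≤ mΩ := by
  cases s with
  | init => exact iSup_le fun j => sup_le (h.measurable_M₀ j).comap_le (h.measurable_G₀ j).comap_le
  | server k => exact (h.measurable_server k).comap_le
  | workers k => exact (h.measurable_workers k).comap_le
  | sample k j => exact (h.measurable_sample k j).comap_le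

theorem IsRandomness.sigmaOf_le (h : IsRandomness μ D θP θD ξ M₀ G₀) (S : Set (Source n)) :
    sigmaOf θP θD ξ M₀ G₀ S ≤ mΩ :=
  iSup₂_le fun s _ => h.sourceSigma_le s

theorem IsRandomness.indepFun (h : IsRandomness μ D θP θD ξ M₀ G₀) {A B : Type*}
    [MeasurableSpace A] [MeasurableSpace B] {Y : Ω → A} {Z : Ω → B} {S : Set (Source n)}
    {s : Source n} (hs : s ∉ S) (hY : Measurable[sigmaOf θP θD ξ M₀ G₀ S] Y)
    (hZ : Measurable[sourceSigma θP θD ξ M₀ G₀ s] Z) : IndepFun Y Z μ := by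
  have h1 := indep_iSup_of_disjoint (m := sourceSigma θP θD ξ M₀ G₀) h.sourceSigma_le
    h.independent (Set.disjoint_singleton_right.2 hs)
  simp only [Set.mem_singleton_iff, iSup_iSup_eq_left] at h1
  rw [IndepFun_iff_Indep]
  exact indep_of_indep_of_le_left (indep_of_indep_of_le_right h1 hZ.comap_le) hY.comap_le

end Sources

/-! ### Square integrability and compressors with random input -/

section Moments

variable {Ω Θ E : Type*} [MeasurableSpace Ω] [MeasurableSpace Θ] {μ : Measure Ω}
  [NormedAddCommGroup E] [InnerProductSpace ℝ E] {p : Seminorm ℝ E}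

omit [InnerProductSpace ℝ E] in
theorem memLp_of_memLp_sub {Y Z : Ω → E} (hY : MemLp Y 2 μ)
    (h : MemLp (fun ω => Z ω - Y ω) 2 μ) : MemLp Z 2 μ :=
  (hY.add h).ae_eq (ae_of_all _ fun ω => add_sub_cancel (Y ω) (Z ω))

theorem integrable_seminorm_sq {K : NNReal} (hp : LipschitzWith K p) {Y : Ω → E}
    (hY : MemLp Y 2 μ) : Integrable (fun ω => p (Y ω) ^ 2) μ := by
  have h1 : MemLp (fun ω => p (Y ω)) 2 μ := by
    refine hY.of_le_mul (c := K) (hp.continuous.comp_aestronglyMeasurable hY.1)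
      (ae_of_all _ fun ω => ?_)
    simpa using hp.dist_le_mul (Y ω) 0
  exact h1.integrable_sq

theorem memLp_two_of_integrable_seminorm_sq {c : ℝ} (hp : ∀ x, ‖x‖ ≤ c * p x) {Y : Ω → E}
    (hYm : AEStronglyMeasurable Y μ) (hY : Integrable (fun ω => p (Y ω) ^ 2) μ) :
    MemLp Y 2 μ := by
  refine (memLp_two_iff_integrable_sq_norm hYm).2 ((hY.const_mul (c ^ 2)).mono (hYm.norm.pow 2)
    (ae_of_all _ fun ω => ?_))
  rw [Real.norm_of_nonneg (by positivity), Real.norm_of_nonneg (by positivity), ← mul_pow]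
  exact pow_le_pow_left₀ (norm_nonneg _) (hp _) 2

variable [MeasurableSpace E] [BorelSpace E] [SecondCountableTopology E] [IsProbabilityMeasure μ]

theorem IsContractive.integral_comp_le {α : ℝ} {θ : Ω → Θ} {C : Θ → E → E}
    (hC : IsContractive p α (μ.map θ) C) {K : NNReal} (hp : LipschitzWith K p)
    (hθ : Measurable θ) {Y : Ω → E} (hYm : Measurable Y) (hYθ : IndepFun Y θ μ)
    (hY : MemLp Y 2 μ) :
    Integrable (fun ω => p (C (θ ω) (Y ω) - Y ω) ^ 2) μ ∧
      ∫ ω, p (C (θ ω) (Y ω) - Y ω) ^ 2 ∂μ ≤ ∫ ω, (1 - α) * p (Y ω) ^ 2 ∂μ := by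
  refine integrable_comp_indepFun (h := fun q => p (C q.2 q.1 - q.1) ^ 2)
    (g := fun y => (1 - α) * p y ^ 2) hYm hθ hYθ ?_ (fun q => by positivity)
    hC.integrable hC.contract ((integrable_seminorm_sq hp hY).const_mul _)
  exact (hp.continuous.measurable.comp
    ((hC.measurable.comp measurable_swap).sub measurable_fst)).pow_const 2

end Moments

section Loss

variable {E : Type*} [NormedAddCommGroup E] [InnerProductSpace ℝ E] [CompleteSpace E]
  {N : Seminorm ℝ E} {ρlo ρhi L : ℝ} {f : E → ℝ}
  {Ω : Type*} [MeasurableSpace Ω] {μ : Measure Ω} [IsProbabilityMeasure μ]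

theorem IsSmooth.memLp_gradient (hN : NormEquivalence N ρlo ρhi) (hf : IsSmooth N L f)
    {Y : Ω → E} (hY : MemLp Y 2 μ) : MemLp (fun ω => gradient f (Y ω)) 2 μ := by
  have hl := hf.lipschitzWith_gradient hN
  have h1 : MemLp (fun ω => gradient f (Y ω) - gradient f 0) 2 μ := by
    refine hY.of_le_mul (c := (L / ρlo * ρlo⁻¹).toNNReal)
      ((hl.continuous.comp_aestronglyMeasurable hY.1).sub aestronglyMeasurable_const)
      (ae_of_all _ fun ω => ?_)
    rw [← dist_eq_norm]
    simpa using hl.dist_le_mul (Y ω) 0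
  exact memLp_of_memLp_sub (memLp_const (gradient f 0)) h1

theorem IsSmooth.integrable_comp (hN : NormEquivalence N ρlo ρhi) (hf : IsSmooth N L f)
    {c : ℝ} (hc : ∀ X, c ≤ f X) {Y : Ω → E} (hY : MemLp Y 2 μ) :
    Integrable (fun ω => f (Y ω)) μ := by
  have h1 : Integrable (fun ω => f 0 - c + inner ℝ (gradient f 0) (Y ω) + L / 2 * N (Y ω) ^ 2) μ :=
    ((integrable_const _).add ((hY.integrable one_le_two).const_inner _)).add
      ((integrable_seminorm_sq hN.lipschitzWith hY).const_mul _)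
  have h2 : Integrable (fun ω => f (Y ω) - c) μ := by
    refine h1.mono' ((hf.differentiable.continuous.comp_aestronglyMeasurable hY.1).sub
      aestronglyMeasurable_const) (ae_of_all _ fun ω => ?_)
    rw [Real.norm_of_nonneg (sub_nonneg.2 (hc _))]
    have := hf.descent hN 0 (Y ω)
    rw [zero_add] at this
    linarith
  exact (h2.add (integrable_const c)).congr (ae_of_all _ fun ω => sub_add_cancel (f (Y ω)) c)

omit [CompleteSpace E] [IsProbabilityMeasure μ] in
theorem NormEquivalence.memLp_dualNorm (hN : NormEquivalence N ρlo ρhi) {Y : Ω → E}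
    (hY : MemLp Y 2 μ) : MemLp (fun ω => dualNorm N (Y ω)) 2 μ :=
  hY.of_le_mul (c := ρhi) (hN.lipschitzWith_dualNorm.continuous.comp_aestronglyMeasurable hY.1)
    (ae_of_all _ fun ω => by
      rw [Real.norm_of_nonneg (hN.dualNorm_nonneg _)]
      exact hN.dualNorm_le_norm _)

omit [CompleteSpace E] [IsProbabilityMeasure μ] in
theorem memLp_avg {n : ℕ} {v : Fin n → Ω → E} (hv : ∀ j, MemLp (v j) 2 μ) :
    MemLp (fun ω => avg fun j => v j ω) 2 μ :=
  (memLp_finsetSum _ fun j _ => hv j).const_smul (1 / (n : ℝ))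

end Loss

/-! ### Adaptedness, integrability and noise along a run -/

section Run

variable {E : Type*} [NormedAddCommGroup E] [InnerProductSpace ℝ E] [CompleteSpace E]
  [MeasurableSpace E] {n : ℕ} {Ξ : Fin n → Type*} [∀ j, MeasurableSpace (Ξ j)]
  {Ω ΘP ΘD : Type*} [mΩ : MeasurableSpace Ω] [MeasurableSpace ΘP] [MeasurableSpace ΘD]

/-- The standing assumptions of the convergence analysis. -/
structure Model (N : Seminorm ℝ E) (ρlo ρhi : ℝ) (D : ∀ j, Measure (Ξ j)) (F : ∀ j, E → Ξ j → ℝ)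
    (L : ℝ) (Lj : Fin n → ℝ) (σ : ℝ) (μ : Measure Ω) (θP : ℕ → Ω → ΘP) (θD : ℕ → Ω → ΘD)
    (ξ : ℕ → ∀ j, Ω → Ξ j) (lmo : E → ℝ → E → E) (αP αD : ℝ) (CP : ℕ → ΘP → E → E)
    (CD : ℕ → Fin n → ΘD → E → E) (β γ : ℝ) (X₀ : E) (X W : ℕ → Ω → E)
    (M G : ℕ → Fin n → Ω → E) : Prop where
  equiv : NormEquivalence N ρlo ρhi
  card_pos : 0 < n
  smooth : IsSmooth N L (globalLoss D F)
  smooth_local : ∀ j, IsSmooth N (Lj j) (localLoss D F j)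
  variance : BoundedVariance D F σ
  lmo_measurable : Measurable (fun q : E × ℝ × E => lmo q.1 q.2.1 q.2.2)
  isLMO : ∀ c t G, 0 ≤ t → IsLMO N c t G (lmo c t G)
  server : ∀ k, IsContractive N αP (μ.map (θP k)) (CP k)
  workers : ∀ k j, IsContractive (normSeminorm ℝ E) αD (μ.map (θD k)) (CD k j)
  randomness : IsRandomness μ D θP θD ξ (M 0) (G 0)
  run : IsRun N F β γ lmo CP CD θP θD ξ X₀ X W M G
  beta_pos : 0 < β
  beta_le_one : β ≤ 1
  gamma_nonneg : 0 ≤ γ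

/-- The gradient noise of worker `j` in round `k`. -/
noncomputable def noise (D : ∀ j, Measure (Ξ j)) (F : ∀ j, E → Ξ j → ℝ) (ξ : ℕ → ∀ j, Ω → Ξ j)
    (W : ℕ → Ω → E) (k : ℕ) (j : Fin n) (ω : Ω) : E :=
  stochGrad F j (W (k + 1) ω) (ξ (k + 1) j ω) - gradient (localLoss D F j) (W (k + 1) ω)

variable {N : Seminorm ℝ E} {ρlo ρhi : ℝ} {D : ∀ j, Measure (Ξ j)} {F : ∀ j, E → Ξ j → ℝ}
  {L : ℝ} {Lj : Fin n → ℝ} {σ : ℝ} {μ : Measure Ω} {θP : ℕ → Ω → ΘP} {θD : ℕ → Ω → ΘD}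
  {ξ : ℕ → ∀ j, Ω → Ξ j} {lmo : E → ℝ → E → E} {αP αD : ℝ} {CP : ℕ → ΘP → E → E}
  {CD : ℕ → Fin n → ΘD → E → E} {β γ : ℝ} {X₀ : E} {X W : ℕ → Ω → E} {M G : ℕ → Fin n → Ω → E}

omit [CompleteSpace E] [InnerProductSpace ℝ E] [NormedAddCommGroup E] mΩ in
theorem measurable_of_time_le {A : Type*} [MeasurableSpace A] {M₀ G₀ : Fin n → Ω → E}
    {Y : Ω → A} {r r' : ℕ} (hr : r ≤ r')
    (hY : Measurable[sigmaOf θP θD ξ M₀ G₀ {s : Source n | s.time ≤ r}] Y) :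
    Measurable[sigmaOf θP θD ξ M₀ G₀ {s : Source n | s.time ≤ r'}] Y :=
  hY.mono (sigmaOf_mono fun _ hs => le_trans hs hr) le_rfl

omit [CompleteSpace E] [InnerProductSpace ℝ E] [NormedAddCommGroup E] mΩ in
theorem measurable_of_source {A : Type*} [MeasurableSpace A] {M₀ G₀ : Fin n → Ω → E}
    {Y : Ω → A} {s : Source n} {S : Set (Source n)} (hs : s ∈ S)
    (hY : Measurable[sourceSigma θP θD ξ M₀ G₀ s] Y) : Measurable[sigmaOf θP θD ξ M₀ G₀ S] Y :=
  hY.mono (sourceSigma_le_sigmaOf hs) le_rfl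

variable [BorelSpace E] [SecondCountableTopology E]

omit [SecondCountableTopology E] in
theorem Model.measurable_gradient
    (h : Model N ρlo ρhi D F L Lj σ μ θP θD ξ lmo αP αD CP CD β γ X₀ X W M G) (j : Fin n) :
    Measurable (gradient (localLoss D F j)) :=
  ((h.smooth_local j).lipschitzWith_gradient h.equiv).continuous.measurable

/-- The σ-algebra `m` is arbitrary here and in the next three lemmas, so that each update can be
placed at its own stage of the filtration. -/
theorem Model.measurable_X_succ
    (h : Model N ρlo ρhi D F L Lj σ μ θP θD ξ lmo αP αD CP CD β γ X₀ X W M G) (k : ℕ) :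
    ∀ m : MeasurableSpace Ω, Measurable[m] (X k) → (∀ j, Measurable[m] (G k j)) →
      Measurable[m] (X (k + 1)) := by
  rw [funext (h.run.X_succ k)]
  have h3 := h.equiv.lipschitzWith_dualNorm.continuous.measurable
  have h4 := h.lmo_measurable
  clear h
  intro m hX hG
  have h1 : Measurable[m] fun ω => avg fun j => G k j ω :=
    (Finset.measurable_fun_sum _ fun j _ => hG j).const_smul (1 / (n : ℝ))
  have h2 : Measurable[m] fun ω => γ * dualNorm N (avg fun j => G k j ω) :=
    (h3.comp h1).const_mul γ
  exact h4.comp (hX.prodMk (h2.prodMk h1))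

theorem Model.measurable_W_succ
    (h : Model N ρlo ρhi D F L Lj σ μ θP θD ξ lmo αP αD CP CD β γ X₀ X W M G) (k : ℕ) :
    ∀ m : MeasurableSpace Ω, Measurable[m] (X (k + 1)) → Measurable[m] (W k) →
      Measurable[m] (θP k) → Measurable[m] (W (k + 1)) := by
  rw [funext (h.run.W_succ k)]
  have h1 := (h.server k).measurable
  clear h
  intro m hX hW hθ
  exact hW.add (h1.comp (hθ.prodMk (hX.sub hW)))

theorem Model.measurable_M_succ
    (h : Model N ρlo ρhi D F L Lj σ μ θP θD ξ lmo αP αD CP CD β γ X₀ X W M G) (k : ℕ) (j : Fin n) :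
    ∀ m : MeasurableSpace Ω, Measurable[m] (M k j) → Measurable[m] (W (k + 1)) →
      Measurable[m] (ξ (k + 1) j) → Measurable[m] (M (k + 1) j) := by
  rw [funext (h.run.M_succ k j)]
  have h1 := h.variance.measurable j
  clear h
  intro m hM hW hξ
  exact (hM.const_smul _).add ((h1.comp (hW.prodMk hξ)).const_smul β)

theorem Model.measurable_G_succ
    (h : Model N ρlo ρhi D F L Lj σ μ θP θD ξ lmo αP αD CP CD β γ X₀ X W M G) (k : ℕ) (j : Fin n) :
    ∀ m : MeasurableSpace Ω, Measurable[m] (M (k + 1) j) → Measurable[m] (G k j) →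
      Measurable[m] (θD k) → Measurable[m] (G (k + 1) j) := by
  rw [funext (h.run.G_succ k j)]
  have h1 := (h.workers k j).measurable
  clear h
  intro m hM hG hθ
  exact hG.add (h1.comp (hθ.prodMk (hM.sub hG)))

theorem Model.adapted
    (h : Model N ρlo ρhi D F L Lj σ μ θP θD ξ lmo αP αD CP CD β γ X₀ X W M G) (k : ℕ) :
    Measurable[sigmaOf θP θD ξ (M 0) (G 0) {s : Source n | s.time ≤ 3 * k}] (X k) ∧
    Measurable[sigmaOf θP θD ξ (M 0) (G 0) {s : Source n | s.time ≤ 3 * k}] (W k) ∧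
    (∀ j, Measurable[sigmaOf θP θD ξ (M 0) (G 0) {s : Source n | s.time ≤ 3 * k}] (M k j)) ∧
    ∀ j, Measurable[sigmaOf θP θD ξ (M 0) (G 0) {s : Source n | s.time ≤ 3 * k}] (G k j) := by
  induction k with
  | zero =>
    refine ⟨?_, ?_, fun j => ?_, fun j => ?_⟩
    · rw [funext h.run.X_zero]
      exact measurable_const
    · rw [funext h.run.W_zero]
      exact measurable_const
    · refine measurable_of_source (s := .init) (le_refl 0) ?_
      exact (comap_measurable (M 0 j)).mono (le_sup_left.trans (le_iSup (fun j =>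
        MeasurableSpace.comap (M 0 j) inferInstance ⊔ MeasurableSpace.comap (G 0 j) inferInstance)
        j)) le_rfl
    · refine measurable_of_source (s := .init) (le_refl 0) ?_
      exact (comap_measurable (G 0 j)).mono (le_sup_right.trans (le_iSup (fun j =>
        MeasurableSpace.comap (M 0 j) inferInstance ⊔ MeasurableSpace.comap (G 0 j) inferInstance)
        j)) le_rfl
  | succ k ih =>
    obtain ⟨hX, hW, hM, hG⟩ := ih
    have h3 : 3 * k ≤ 3 * (k + 1) := by omega
    have hX' := h.measurable_X_succ _ _ (measurable_of_time_le h3 hX)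
      fun j => measurable_of_time_le h3 (hG j)
    have hW' := h.measurable_W_succ _ _ hX' (measurable_of_time_le h3 hW)
      (measurable_of_source (s := .server k) (by simp only [Set.mem_ofPred_eq, Source.time]; omega)
        (comap_measurable (θP k)))
    have hM' := fun j => h.measurable_M_succ _ _ _ (measurable_of_time_le h3 (hM j)) hW'
      (measurable_of_source (s := .sample k j)
        (by simp only [Set.mem_ofPred_eq, Source.time]; omega) (comap_measurable (ξ (k + 1) j)))
    exact ⟨hX', hW', hM', fun j => h.measurable_G_succ _ _ _ (hM' j) (measurable_of_time_le h3 (hG j))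
      (measurable_of_source (s := .workers k)
        (by simp only [Set.mem_ofPred_eq, Source.time]; omega) (comap_measurable (θD k)))⟩

/-- The oracle is deterministic, so this update consumes no new randomness; hence $X^{k+1}-W^k$ is
independent of the server compressor drawn at time $3k+1$. -/
theorem Model.adapted_X_succ
    (h : Model N ρlo ρhi D F L Lj σ μ θP θD ξ lmo αP αD CP CD β γ X₀ X W M G) (k : ℕ) :
    Measurable[sigmaOf θP θD ξ (M 0) (G 0) {s : Source n | s.time ≤ 3 * k}] (X (k + 1)) :=
  h.measurable_X_succ _ _ (h.adapted k).1 (h.adapted k).2.2.2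

theorem Model.adapted_W_succ
    (h : Model N ρlo ρhi D F L Lj σ μ θP θD ξ lmo αP αD CP CD β γ X₀ X W M G) (k : ℕ) :
    Measurable[sigmaOf θP θD ξ (M 0) (G 0) {s : Source n | s.time ≤ 3 * k + 1}] (W (k + 1)) :=
  h.measurable_W_succ _ _ (measurable_of_time_le (Nat.le_succ _) (h.adapted_X_succ k))
    (measurable_of_time_le (Nat.le_succ _) (h.adapted k).2.1)
    (measurable_of_source (s := .server k) (le_refl (3 * k + 1)) (comap_measurable (θP k)))

theorem Model.adapted_M_succ
    (h : Model N ρlo ρhi D F L Lj σ μ θP θD ξ lmo αP αD CP CD β γ X₀ X W M G) (k : ℕ) (j : Fin n) :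
    Measurable[sigmaOf θP θD ξ (M 0) (G 0) {s : Source n | s.time ≤ 3 * k + 2}] (M (k + 1) j) :=
  h.measurable_M_succ _ _ _ (measurable_of_time_le (by omega) ((h.adapted k).2.2.1 j))
    (measurable_of_time_le (by omega) (h.adapted_W_succ k))
    (measurable_of_source (s := .sample k j) (le_refl (3 * k + 2))
      (comap_measurable (ξ (k + 1) j)))

omit [BorelSpace E] [SecondCountableTopology E] in
theorem Model.measurable_of_sigmaOf
    (h : Model N ρlo ρhi D F L Lj σ μ θP θD ξ lmo αP αD CP CD β γ X₀ X W M G) {A : Type*}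
    [MeasurableSpace A] {Y : Ω → A} {S : Set (Source n)}
    (hY : Measurable[sigmaOf θP θD ξ (M 0) (G 0) S] Y) : Measurable Y :=
  hY.mono (h.randomness.sigmaOf_le S) le_rfl

variable [IsProbabilityMeasure μ]

theorem Model.noise_moments
    (h : Model N ρlo ρhi D F L Lj σ μ θP θD ξ lmo αP αD CP CD β γ X₀ X W M G) (k : ℕ) (j : Fin n) :
    MemLp (noise D F ξ W k j) 2 μ ∧ ∫ ω, ‖noise D F ξ W k j ω‖ ^ 2 ∂μ ≤ σ ^ 2 := by
  have hW := h.measurable_of_sigmaOf (h.adapted_W_succ k)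
  have hξ := h.randomness.measurable_sample k j
  have hm : Measurable fun q : E × Ξ j =>
      stochGrad F j q.1 q.2 - gradient (localLoss D F j) q.1 :=
    (h.variance.measurable j).sub ((h.measurable_gradient j).comp measurable_fst)
  have hind : IndepFun (W (k + 1)) (ξ (k + 1) j) μ :=
    h.randomness.indepFun (s := .sample k j) (by simp [Source.time]) (h.adapted_W_succ k)
      (comap_measurable (ξ (k + 1) j))
  have h1 := integrable_comp_indepFun (h := fun q : E × Ξ j =>
      ‖stochGrad F j q.1 q.2 - gradient (localLoss D F j) q.1‖ ^ 2) (g := fun _ => σ ^ 2)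
    hW hξ hind (hm.norm.pow_const 2) (fun _ => by positivity)
    (fun y => by rw [h.randomness.law_sample]; exact h.variance.sq_integrable j y)
    (fun y => by rw [h.randomness.law_sample]; exact h.variance.variance_le j y)
    (integrable_const _)
  refine ⟨(memLp_two_iff_integrable_sq_norm (hm.comp (hW.prodMk hξ)).aestronglyMeasurable).2 h1.1,
    h1.2.trans_eq (by simp)⟩

omit [IsProbabilityMeasure μ] in
theorem Model.memLp_X_succ
    (h : Model N ρlo ρhi D F L Lj σ μ θP θD ξ lmo αP αD CP CD β γ X₀ X W M G) {k : ℕ}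
    (hX : MemLp (X k) 2 μ) (hG : ∀ j, MemLp (G k j) 2 μ) : MemLp (X (k + 1)) 2 μ := by
  have h1 := h.equiv.memLp_dualNorm (memLp_avg hG)
  have h2 : MemLp (fun ω => X (k + 1) ω - X k ω) 2 μ := by
    refine h1.of_le_mul (c := ρhi * γ)
      ((h.measurable_of_sigmaOf (h.adapted (k + 1)).1).sub
        (h.measurable_of_sigmaOf (h.adapted k).1)).aestronglyMeasurable (ae_of_all _ fun ω => ?_)
    rw [Real.norm_of_nonneg (h.equiv.dualNorm_nonneg _), h.run.X_succ, mul_assoc]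
    exact (h.equiv.upper _).trans (mul_le_mul_of_nonneg_left
      (h.isLMO _ _ _ (mul_nonneg h.gamma_nonneg (h.equiv.dualNorm_nonneg _))).1 h.equiv.hi_pos.le)
  exact memLp_of_memLp_sub hX h2

theorem Model.server_moments
    (h : Model N ρlo ρhi D F L Lj σ μ θP θD ξ lmo αP αD CP CD β γ X₀ X W M G) {k : ℕ}
    (hX : MemLp (X (k + 1)) 2 μ) (hW : MemLp (W k) 2 μ) :
    MemLp (fun ω => W (k + 1) ω - X (k + 1) ω) 2 μ ∧
    ∫ ω, N (W (k + 1) ω - X (k + 1) ω) ^ 2 ∂μ ≤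
      ∫ ω, (1 - αP) * N (X (k + 1) ω - W k ω) ^ 2 ∂μ := by
  have hm := (h.adapted_X_succ k).sub (h.adapted k).2.1
  have h1 := (h.server k).integral_comp_le h.equiv.lipschitzWith (h.randomness.measurable_server k)
    (h.measurable_of_sigmaOf hm)
    (h.randomness.indepFun (s := .server k) (by simp [Source.time]) hm (comap_measurable (θP k)))
    (hX.sub hW)
  have h2 : ∀ ω, CP k (θP k ω) ((X (k + 1) - W k) ω) - (X (k + 1) - W k) ω =
      W (k + 1) ω - X (k + 1) ω := by
    intro ω
    rw [h.run.W_succ, Pi.sub_apply]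
    abel
  simp only [h2] at h1
  exact ⟨memLp_two_of_integrable_seminorm_sq h.equiv.upper
    ((h.measurable_of_sigmaOf (h.adapted (k + 1)).2.1).sub
      (h.measurable_of_sigmaOf (h.adapted (k + 1)).1)).aestronglyMeasurable h1.1, h1.2⟩

omit [BorelSpace E] [SecondCountableTopology E] [IsProbabilityMeasure μ] in
theorem Model.M_succ_eq
    (h : Model N ρlo ρhi D F L Lj σ μ θP θD ξ lmo αP αD CP CD β γ X₀ X W M G) (k : ℕ) (j : Fin n)
    (ω : Ω) : M (k + 1) j ω = (1 - β) • M k j ω +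
      β • (gradient (localLoss D F j) (W (k + 1) ω) + noise D F ξ W k j ω) := by
  rw [h.run.M_succ, noise, add_sub_cancel]

theorem Model.memLp_M_succ
    (h : Model N ρlo ρhi D F L Lj σ μ θP θD ξ lmo αP αD CP CD β γ X₀ X W M G) {k : ℕ} {j : Fin n}
    (hM : MemLp (M k j) 2 μ) (hW : MemLp (W (k + 1)) 2 μ) : MemLp (M (k + 1) j) 2 μ := by
  rw [funext (h.M_succ_eq k j)]
  exact (hM.const_smul (1 - β)).add ((((h.smooth_local j).memLp_gradient h.equiv hW).add
    (h.noise_moments k j).1).const_smul β)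

theorem Model.workers_moments
    (h : Model N ρlo ρhi D F L Lj σ μ θP θD ξ lmo αP αD CP CD β γ X₀ X W M G) {k : ℕ} {j : Fin n}
    (hM : MemLp (M (k + 1) j) 2 μ) (hG : MemLp (G k j) 2 μ) :
    MemLp (fun ω => G (k + 1) j ω - M (k + 1) j ω) 2 μ ∧
    ∫ ω, ‖G (k + 1) j ω - M (k + 1) j ω‖ ^ 2 ∂μ ≤
      ∫ ω, (1 - αD) * ‖M (k + 1) j ω - G k j ω‖ ^ 2 ∂μ := by
  have hm := (h.adapted_M_succ k j).sub
    (measurable_of_time_le (Nat.le_add_right _ 2) ((h.adapted k).2.2.2 j))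
  have h1 := (h.workers k j).integral_comp_le (p := normSeminorm ℝ E) (K := 1)
    (by simpa using lipschitzWith_one_norm) (h.randomness.measurable_workers k)
    (h.measurable_of_sigmaOf hm)
    (h.randomness.indepFun (s := .workers k) (by simp [Source.time]) hm (comap_measurable (θD k)))
    (hM.sub hG)
  have h2 : ∀ ω, CD k j (θD k ω) ((M (k + 1) j - G k j) ω) - (M (k + 1) j - G k j) ω =
      G (k + 1) j ω - M (k + 1) j ω := by
    intro ω
    rw [h.run.G_succ, Pi.sub_apply]
    abel
  simp only [h2] at h1
  exact ⟨memLp_two_of_integrable_seminorm_sq (p := normSeminorm ℝ E) (c := 1) (by simp)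
    ((h.measurable_of_sigmaOf ((h.adapted (k + 1)).2.2.2 j)).sub
      (h.measurable_of_sigmaOf ((h.adapted (k + 1)).2.2.1 j))).aestronglyMeasurable h1.1, h1.2⟩

/-- Provides the integrability behind every later comparison of expectations; a Bochner integral of
a non-integrable function would be zero by convention. -/
theorem Model.memLp
    (h : Model N ρlo ρhi D F L Lj σ μ θP θD ξ lmo αP αD CP CD β γ X₀ X W M G) (k : ℕ) :
    MemLp (X k) 2 μ ∧ MemLp (W k) 2 μ ∧ (∀ j, MemLp (M k j) 2 μ) ∧ ∀ j, MemLp (G k j) 2 μ := by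
  induction k with
  | zero =>
    refine ⟨?_, ?_, h.randomness.memLp_M₀, h.randomness.memLp_G₀⟩
    · rw [funext h.run.X_zero]
      exact memLp_const _
    · rw [funext h.run.W_zero]
      exact memLp_const _
  | succ k ih =>
    obtain ⟨hX, hW, hM, hG⟩ := ih
    have hX' := h.memLp_X_succ hX hG
    have hW' : MemLp (W (k + 1)) 2 μ := 
      memLp_of_memLp_sub hX' (h.server_moments hX' hW).1
    have hM' := fun j => h.memLp_M_succ (hM j) hW'
    exact ⟨hX', hW', hM', fun j => 
      memLp_of_memLp_sub (hM' j) (h.workers_moments (hM' j) (hG j)).1⟩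

/-- The set `S` is left general because two uses occur: all draws up to time $3k+1$, for the drift,
and the same together with the sample of another worker, for noise against noise. -/
theorem Model.integral_inner_noise
    (h : Model N ρlo ρhi D F L Lj σ μ θP θD ξ lmo αP αD CP CD β γ X₀ X W M G) (k : ℕ) (j : Fin n)
    {S : Set (Source n)} (hS : {s : Source n | s.time ≤ 3 * k + 1} ⊆ S) (hj : .sample k j ∉ S)
    {A : Ω → E} (hA : Measurable[sigmaOf θP θD ξ (M 0) (G 0) S] A) (hA' : MemLp A 2 μ) :
    ∫ ω, inner ℝ (A ω) (noise D F ξ W k j ω) ∂μ = 0 := by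
  have hW : Measurable[sigmaOf θP θD ξ (M 0) (G 0) S] (W (k + 1)) :=
    (h.adapted_W_succ k).mono (sigmaOf_mono hS) le_rfl
  have hAW := hA.prodMk hW
  refine integral_inner_indepFun_eq_zero (Y := fun ω => (A ω, W (k + 1) ω)) (Z := ξ (k + 1) j)
    (A := fun q => q.1) (φ := fun q : (E × E) × Ξ j =>
      stochGrad F j q.1.2 q.2 - gradient (localLoss D F j) q.1.2)
    (h.measurable_of_sigmaOf hAW) (h.randomness.measurable_sample k j)
    (h.randomness.indepFun hj hAW (comap_measurable (ξ (k + 1) j))) measurable_fst ?_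
    (fun y => ?_) (fun y => ?_) hA' (h.noise_moments k j).1
  · exact ((h.variance.measurable j).comp
      ((measurable_snd.comp measurable_fst).prodMk measurable_snd)).sub
      ((h.measurable_gradient j).comp (measurable_snd.comp measurable_fst))
  · have := h.variance.isProbability j
    rw [h.randomness.law_sample]
    exact (h.variance.grad_integrable j y.2).sub
      (integrable_const (gradient (localLoss D F j) y.2))
  · have := h.variance.isProbability j
    rw [h.randomness.law_sample]
    change ∫ z, stochGrad F j y.2 z - gradient (localLoss D F j) y.2 ∂(D j) = 0
    rw [integral_sub (h.variance.grad_integrable j y.2)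
      (integrable_const _), h.variance.unbiased]
    simp

theorem Model.integral_inner_noise_noise
    (h : Model N ρlo ρhi D F L Lj σ μ θP θD ξ lmo αP αD CP CD β γ X₀ X W M G) (k : ℕ)
    {i j : Fin n} (hij : i ≠ j) :
    ∫ ω, inner ℝ (noise D F ξ W k i ω) (noise D F ξ W k j ω) ∂μ = 0 := by
  have hs : {s : Source n | s.time ≤ 3 * k + 1} ⊆
      insert (.sample k i) {s : Source n | s.time ≤ 3 * k + 1} := Set.subset_insert _ _
  refine h.integral_inner_noise k j hs (by simp [Source.time, hij.symm]) ?_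
    (h.noise_moments k i).1
  have hW := (h.adapted_W_succ k).mono (sigmaOf_mono hs) le_rfl
  exact ((h.variance.measurable i).comp (hW.prodMk (measurable_of_source (Set.mem_insert _ _)
    (comap_measurable (ξ (k + 1) i))))).sub ((h.measurable_gradient i).comp hW)

end Run

/-! ### Integrated inequalities -/

section Integral

variable {Ω : Type*} [MeasurableSpace Ω] {μ : Measure Ω}

theorem integral_le_two {φ f₁ f₂ : Ω → ℝ} {a b : ℝ} (hφ : Integrable φ μ) (h₁ : Integrable f₁ μ)
    (h₂ : Integrable f₂ μ) (h : ∀ ω, φ ω ≤ a * f₁ ω + b * f₂ ω) :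
    ∫ ω, φ ω ∂μ ≤ a * ∫ ω, f₁ ω ∂μ + b * ∫ ω, f₂ ω ∂μ := by
  rw [← integral_const_mul, ← integral_const_mul,
    ← integral_add (h₁.const_mul a) (h₂.const_mul b)]
  exact integral_mono hφ ((h₁.const_mul a).add (h₂.const_mul b)) h

theorem integral_le_three {φ f₁ f₂ f₃ : Ω → ℝ} {a b c : ℝ} (hφ : Integrable φ μ)
    (h₁ : Integrable f₁ μ) (h₂ : Integrable f₂ μ) (h₃ : Integrable f₃ μ)
    (h : ∀ ω, φ ω ≤ a * f₁ ω + b * f₂ ω + c * f₃ ω) :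
    ∫ ω, φ ω ∂μ ≤ a * ∫ ω, f₁ ω ∂μ + b * ∫ ω, f₂ ω ∂μ + c * ∫ ω, f₃ ω ∂μ := by
  rw [← sub_le_iff_le_add, ← integral_const_mul c, ← integral_sub hφ (h₃.const_mul c)]
  exact integral_le_two (hφ.sub (h₃.const_mul c)) h₁ h₂ fun ω => by linarith [h ω]

theorem integral_le_four {φ f₁ f₂ f₃ f₄ : Ω → ℝ} {a b c d : ℝ} (hφ : Integrable φ μ)
    (h₁ : Integrable f₁ μ) (h₂ : Integrable f₂ μ) (h₃ : Integrable f₃ μ) (h₄ : Integrable f₄ μ)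
    (h : ∀ ω, φ ω ≤ a * f₁ ω + b * f₂ ω + c * f₃ ω + d * f₄ ω) :
    ∫ ω, φ ω ∂μ ≤
      a * ∫ ω, f₁ ω ∂μ + b * ∫ ω, f₂ ω ∂μ + c * ∫ ω, f₃ ω ∂μ + d * ∫ ω, f₄ ω ∂μ := by
  rw [← sub_le_iff_le_add, ← integral_const_mul d, ← integral_sub hφ (h₄.const_mul d)]
  exact integral_le_three (hφ.sub (h₄.const_mul d)) h₁ h₂ h₃ fun ω => by linarith [h ω]

variable {E : Type*} [NormedAddCommGroup E] [InnerProductSpace ℝ E]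

theorem memLp_momentum {β : ℝ} {P Δ R : Ω → E} (hP : MemLp P 2 μ) (hΔ : MemLp Δ 2 μ)
    (hR : MemLp R 2 μ) : MemLp (fun ω => (1 - β) • P ω + (1 - β) • Δ ω + β • R ω) 2 μ :=
  ((hP.const_smul (1 - β)).add (hΔ.const_smul (1 - β))).add (hR.const_smul β)

theorem integral_momentum_le {β : ℝ} (h0 : 0 < β) (h1 : β ≤ 1) {P Δ R Z : Ω → E}
    (hP : MemLp P 2 μ) (hΔ : MemLp Δ 2 μ) (hR : MemLp R 2 μ) (hZ : MemLp Z 2 μ)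
    (hZ0 : ∫ ω, inner ℝ ((1 - β) • P ω + (1 - β) • Δ ω + β • R ω) (Z ω) ∂μ = 0) :
    ∫ ω, ‖(1 - β) • P ω + (1 - β) • Δ ω + β • R ω + (-β) • Z ω‖ ^ 2 ∂μ ≤
      (1 - β) * ∫ ω, ‖P ω‖ ^ 2 ∂μ + 2 / β * ∫ ω, ‖Δ ω‖ ^ 2 ∂μ + 2 * β * ∫ ω, ‖R ω‖ ^ 2 ∂μ +
        β ^ 2 * ∫ ω, ‖Z ω‖ ^ 2 ∂μ := by
  have hA := memLp_momentum (β := β) hP hΔ hR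
  rw [integral_norm_add_smul_sq hA hZ hZ0, neg_sq]
  gcongr
  exact integral_le_three (hA.integrable_norm_pow (by norm_num))
    (hP.integrable_norm_pow (by norm_num)) (hΔ.integrable_norm_pow (by norm_num))
    (hR.integrable_norm_pow (by norm_num)) fun ω => momentum_sq_le h0 h1 _ _ _

end Integral

/-! ### Recursions for the mean-square errors -/

section Run

variable {E : Type*} [NormedAddCommGroup E] [InnerProductSpace ℝ E] [CompleteSpace E]
  [MeasurableSpace E] [BorelSpace E] [SecondCountableTopology E] {n : ℕ} {Ξ : Fin n → Type*}
  [∀ j, MeasurableSpace (Ξ j)] {Ω ΘP ΘD : Type*} [MeasurableSpace Ω] [MeasurableSpace ΘP]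
  [MeasurableSpace ΘD]
  {N : Seminorm ℝ E} {ρlo ρhi : ℝ} {D : ∀ j, Measure (Ξ j)} {F : ∀ j, E → Ξ j → ℝ}
  {L : ℝ} {Lj : Fin n → ℝ} {σ : ℝ} {μ : Measure Ω} [IsProbabilityMeasure μ] {θP : ℕ → Ω → ΘP}
  {θD : ℕ → Ω → ΘD} {ξ : ℕ → ∀ j, Ω → Ξ j} {lmo : E → ℝ → E → E} {αP αD : ℝ}
  {CP : ℕ → ΘP → E → E} {CD : ℕ → Fin n → ΘD → E → E} {β γ : ℝ} {X₀ : E} {X W : ℕ → Ω → E}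
  {M G : ℕ → Fin n → Ω → E}

omit [BorelSpace E] [SecondCountableTopology E] [IsProbabilityMeasure μ] in
theorem Model.step_le
    (h : Model N ρlo ρhi D F L Lj σ μ θP θD ξ lmo αP αD CP CD β γ X₀ X W M G) (k : ℕ) (ω : Ω) :
    N (X (k + 1) ω - X k ω) ^ 2 ≤ (γ * dualNorm N (avg fun j => G k j ω)) ^ 2 := by
  rw [h.run.X_succ]
  exact pow_le_pow_left₀ (apply_nonneg _ _)
    (h.isLMO _ _ _ (mul_nonneg h.gamma_nonneg (h.equiv.dualNorm_nonneg _))).1 2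

theorem Model.integrable_radius_sq
    (h : Model N ρlo ρhi D F L Lj σ μ θP θD ξ lmo αP αD CP CD β γ X₀ X W M G) (k : ℕ) :
    Integrable (fun ω => (γ * dualNorm N (avg fun j => G k j ω)) ^ 2) μ :=
  ((h.equiv.memLp_dualNorm (memLp_avg (h.memLp k).2.2.2)).const_mul γ).integrable_sq

theorem Model.integrable_server_error
    (h : Model N ρlo ρhi D F L Lj σ μ θP θD ξ lmo αP αD CP CD β γ X₀ X W M G) (k : ℕ) :
    Integrable (fun ω => N (X k ω - W k ω) ^ 2) μ :=
  integrable_seminorm_sq h.equiv.lipschitzWith ((h.memLp k).1.sub (h.memLp k).2.1)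

theorem Model.server_recursion
    (h : Model N ρlo ρhi D F L Lj σ μ θP θD ξ lmo αP αD CP CD β γ X₀ X W M G) (k : ℕ) :
    ∫ ω, N (X (k + 1) ω - W (k + 1) ω) ^ 2 ∂μ ≤
      (1 - αP / 2) * ∫ ω, N (X k ω - W k ω) ^ 2 ∂μ +
        2 / αP * ∫ ω, (γ * dualNorm N (avg fun j => G k j ω)) ^ 2 ∂μ := by
  have h1 := (h.server_moments (h.memLp (k + 1)).1 (h.memLp k).2.1).2
  simp only [map_sub_rev N (W (k + 1) _)] at h1
  refine h1.trans (integral_le_two ((integrable_seminorm_sq h.equiv.lipschitzWith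
    ((h.memLp (k + 1)).1.sub (h.memLp k).2.1)).const_mul (1 - αP)) (h.integrable_server_error k)
    (h.integrable_radius_sq k) fun ω => ?_)
  have h0 := (h.server k).pos
  have h2 := contract_add_sq_le N h0 (h.server k).le_one (X k ω - W k ω) (X (k + 1) ω - X k ω)
  rw [sub_add_sub_cancel'] at h2
  exact h2.trans (add_le_add_right (mul_le_mul_of_nonneg_left (h.step_le k ω) (by positivity)) _)

omit [BorelSpace E] [SecondCountableTopology E] in
theorem Model.memLp_gradient_local
    (h : Model N ρlo ρhi D F L Lj σ μ θP θD ξ lmo αP αD CP CD β γ X₀ X W M G) (j : Fin n)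
    {Y : Ω → E} (hY : MemLp Y 2 μ) : MemLp (fun ω => gradient (localLoss D F j) (Y ω)) 2 μ :=
  (h.smooth_local j).memLp_gradient h.equiv hY

omit [IsProbabilityMeasure μ] in
theorem Model.measurable_momentum_drift
    (h : Model N ρlo ρhi D F L Lj σ μ θP θD ξ lmo αP αD CP CD β γ X₀ X W M G) (k : ℕ) (j : Fin n) :
    Measurable[sigmaOf θP θD ξ (M 0) (G 0) {s : Source n | s.time ≤ 3 * k + 1}] fun ω =>
      (1 - β) • (gradient (localLoss D F j) (X k ω) - M k j ω) +
      (1 - β) • (gradient (localLoss D F j) (X (k + 1) ω) - gradient (localLoss D F j) (X k ω)) +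
      β • (gradient (localLoss D F j) (X (k + 1) ω) -
        gradient (localLoss D F j) (W (k + 1) ω)) := by
  have hg := h.measurable_gradient j
  have h1 := hg.comp (measurable_of_time_le (Nat.le_succ _) (h.adapted k).1)
  have h2 := hg.comp (measurable_of_time_le (Nat.le_succ _) (h.adapted_X_succ k))
  have h3 := hg.comp (h.adapted_W_succ k)
  have h4 := measurable_of_time_le (Nat.le_succ _) ((h.adapted k).2.2.1 j)
  exact (((h1.sub h4).const_smul (1 - β)).add ((h2.sub h1).const_smul (1 - β))).add
    ((h2.sub h3).const_smul β)

/-- The new error is $(1-\beta)$ times the old error, plus $(1-\beta)$ times the gradient change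
along the step, plus $\beta$ times the gradient gap caused by the server lag, minus $\beta$ times
the noise, which is orthogonal to the rest. -/
theorem Model.local_momentum_recursion
    (h : Model N ρlo ρhi D F L Lj σ μ θP θD ξ lmo αP αD CP CD β γ X₀ X W M G) (k : ℕ) (j : Fin n) :
    ∫ ω, ‖gradient (localLoss D F j) (X (k + 1) ω) - M (k + 1) j ω‖ ^ 2 ∂μ ≤
      (1 - β) * ∫ ω, ‖gradient (localLoss D F j) (X k ω) - M k j ω‖ ^ 2 ∂μ +
      2 / β * (Lj j ^ 2 / ρlo ^ 2 * ∫ ω, (γ * dualNorm N (avg fun j => G k j ω)) ^ 2 ∂μ) +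
      2 * β * (Lj j ^ 2 / ρlo ^ 2 * ∫ ω, N (X (k + 1) ω - W (k + 1) ω) ^ 2 ∂μ) +
      β ^ 2 * σ ^ 2 := by
  have h0 := h.beta_pos
  have hX := h.memLp_gradient_local j (h.memLp k).1
  have hX' := h.memLp_gradient_local j (h.memLp (k + 1)).1
  have hW' := h.memLp_gradient_local j (h.memLp (k + 1)).2.1
  have hP := hX.sub ((h.memLp k).2.2.1 j)
  have hA := memLp_momentum (β := β) hP (hX'.sub hX) (hX'.sub hW')
  have hZ := h.noise_moments k j
  have h1 := integral_momentum_le h0 h.beta_le_one hP (hX'.sub hX) (hX'.sub hW') hZ.1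
    (h.integral_inner_noise k j subset_rfl (by simp [Source.time])
      (h.measurable_momentum_drift k j) hA)
  simp only [Pi.sub_apply] at h1
  have h2 : ∀ ω, gradient (localLoss D F j) (X (k + 1) ω) - M (k + 1) j ω =
      (1 - β) • (gradient (localLoss D F j) (X k ω) - M k j ω) +
      (1 - β) • (gradient (localLoss D F j) (X (k + 1) ω) - gradient (localLoss D F j) (X k ω)) +
      β • (gradient (localLoss D F j) (X (k + 1) ω) -
        gradient (localLoss D F j) (W (k + 1) ω)) + (-β) • noise D F ξ W k j ω := by
    intro ω
    rw [h.M_succ_eq]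
    module
  simp only [h2]
  refine h1.trans ?_
  gcongr
  · rw [← integral_const_mul]
    refine integral_mono ((hX'.sub hX).integrable_norm_pow (by norm_num))
      ((h.integrable_radius_sq k).const_mul _) fun ω => ?_
    exact ((h.smooth_local j).norm_gradient_sub_sq_le h.equiv _ _).trans
      (mul_le_mul_of_nonneg_left (h.step_le k ω) (by positivity))
  · rw [← integral_const_mul]
    exact integral_mono ((hX'.sub hW').integrable_norm_pow (by norm_num))
      ((h.integrable_server_error (k + 1)).const_mul _)
      fun ω => (h.smooth_local j).norm_gradient_sub_sq_le h.equiv _ _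
  · exact hZ.2

theorem Model.global_momentum_recursion
    (h : Model N ρlo ρhi D F L Lj σ μ θP θD ξ lmo αP αD CP CD β γ X₀ X W M G) (k : ℕ) :
    ∫ ω, ‖gradient (globalLoss D F) (X (k + 1) ω) - avg fun j => M (k + 1) j ω‖ ^ 2 ∂μ ≤
      (1 - β) * ∫ ω, ‖gradient (globalLoss D F) (X k ω) - avg fun j => M k j ω‖ ^ 2 ∂μ +
      2 / β * (L ^ 2 / ρlo ^ 2 * ∫ ω, (γ * dualNorm N (avg fun j => G k j ω)) ^ 2 ∂μ) +
      2 * β * (L ^ 2 / ρlo ^ 2 * ∫ ω, N (X (k + 1) ω - W (k + 1) ω) ^ 2 ∂μ) +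
      β ^ 2 * (σ ^ 2 / n) := by
  have h0 := h.beta_pos
  have hgr := gradient_globalLoss fun j => (h.smooth_local j).differentiable
  have hX := h.smooth.memLp_gradient h.equiv (h.memLp k).1
  have hX' := h.smooth.memLp_gradient h.equiv (h.memLp (k + 1)).1
  have hW' := h.smooth.memLp_gradient h.equiv (h.memLp (k + 1)).2.1
  have hP := hX.sub (memLp_avg (h.memLp k).2.2.1)
  have hA := memLp_momentum (β := β) hP (hX'.sub hX) (hX'.sub hW')
  have hZ := memLp_avg fun j => (h.noise_moments k j).1
  -- The global drift is the average of the local drifts, and inherits their measurability.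
  have hm : Measurable[sigmaOf θP θD ξ (M 0) (G 0) {s : Source n | s.time ≤ 3 * k + 1}] fun ω =>
      avg fun j => (1 - β) • (gradient (localLoss D F j) (X k ω) - M k j ω) +
      (1 - β) • (gradient (localLoss D F j) (X (k + 1) ω) - gradient (localLoss D F j) (X k ω)) +
      β • (gradient (localLoss D F j) (X (k + 1) ω) -
        gradient (localLoss D F j) (W (k + 1) ω)) :=
    (Finset.measurable_fun_sum _ fun j _ => h.measurable_momentum_drift k j).const_smul (1 / (n : ℝ))
  simp only [avg_add, avg_smul, avg_sub, ← hgr] at hm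
  have h3 := integral_inner_avg_eq_zero hA (fun j => (h.noise_moments k j).1) fun j =>
    h.integral_inner_noise k j subset_rfl (by simp [Source.time]) hm hA
  have h1 := integral_momentum_le h0 h.beta_le_one hP (hX'.sub hX) (hX'.sub hW') hZ h3
  simp only [Pi.sub_apply] at h1
  have h2 : ∀ ω, gradient (globalLoss D F) (X (k + 1) ω) - (avg fun j => M (k + 1) j ω) =
      (1 - β) • (gradient (globalLoss D F) (X k ω) - avg fun j => M k j ω) +
      (1 - β) • (gradient (globalLoss D F) (X (k + 1) ω) - gradient (globalLoss D F) (X k ω)) +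
      β • (gradient (globalLoss D F) (X (k + 1) ω) - gradient (globalLoss D F) (W (k + 1) ω)) +
      (-β) • avg fun j => noise D F ξ W k j ω := by
    intro ω
    simp only [h.M_succ_eq, avg_add, avg_smul, ← hgr]
    module
  simp only [h2]
  refine h1.trans ?_
  gcongr
  · rw [← integral_const_mul]
    refine integral_mono ((hX'.sub hX).integrable_norm_pow (by norm_num))
      ((h.integrable_radius_sq k).const_mul _) fun ω => ?_
    exact (h.smooth.norm_gradient_sub_sq_le h.equiv _ _).trans
      (mul_le_mul_of_nonneg_left (h.step_le k ω) (by positivity))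
  · rw [← integral_const_mul]
    exact integral_mono ((hX'.sub hW').integrable_norm_pow (by norm_num))
      ((h.integrable_server_error (k + 1)).const_mul _)
      fun ω => h.smooth.norm_gradient_sub_sq_le h.equiv _ _
  · exact integral_norm_avg_sq_le h.card_pos (fun j => (h.noise_moments k j).1)
      (fun i j hij => h.integral_inner_noise_noise k hij) fun j => (h.noise_moments k j).2

/-- The noise is split off by orthogonality before Young's inequality is applied, so $\sigma^2$ does
not acquire a factor $1/\alpha_D$. The remaining change of momentum is a sum of three errors, whence
$6/\alpha_D=3\cdot2/\alpha_D$. -/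
theorem Model.compression_recursion
    (h : Model N ρlo ρhi D F L Lj σ μ θP θD ξ lmo αP αD CP CD β γ X₀ X W M G) (k : ℕ) (j : Fin n) :
    ∫ ω, ‖M (k + 1) j ω - G (k + 1) j ω‖ ^ 2 ∂μ ≤
      (1 - αD / 2) * ∫ ω, ‖M k j ω - G k j ω‖ ^ 2 ∂μ +
      6 / αD * β ^ 2 * ∫ ω, ‖gradient (localLoss D F j) (X k ω) - M k j ω‖ ^ 2 ∂μ +
      6 / αD * β ^ 2 * (Lj j ^ 2 / ρlo ^ 2) *
        ∫ ω, (γ * dualNorm N (avg fun j => G k j ω)) ^ 2 ∂μ +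
      6 / αD * β ^ 2 * (Lj j ^ 2 / ρlo ^ 2) * ∫ ω, N (X (k + 1) ω - W (k + 1) ω) ^ 2 ∂μ +
      β ^ 2 * σ ^ 2 := by
  have h0 := (h.workers k j).pos
  have h1 := (h.workers k j).le_one
  have hX := h.memLp_gradient_local j (h.memLp k).1
  have hW' := h.memLp_gradient_local j (h.memLp (k + 1)).2.1
  have hM := (h.memLp k).2.2.1 j
  have hG := (h.memLp k).2.2.2 j
  have hZ := h.noise_moments k j
  have hA : MemLp (fun ω => M k j ω - G k j ω +
      β • (gradient (localLoss D F j) (W (k + 1) ω) - M k j ω)) 2 μ :=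
    (hM.sub hG).add ((hW'.sub hM).const_smul β)
  have hAm : Measurable[sigmaOf θP θD ξ (M 0) (G 0) {s : Source n | s.time ≤ 3 * k + 1}] fun ω =>
      M k j ω - G k j ω + β • (gradient (localLoss D F j) (W (k + 1) ω) - M k j ω) := by
    have h4 := measurable_of_time_le (Nat.le_succ _) ((h.adapted k).2.2.1 j)
    have h5 := measurable_of_time_le (Nat.le_succ _) ((h.adapted k).2.2.2 j)
    exact (h4.sub h5).add ((((h.measurable_gradient j).comp (h.adapted_W_succ k)).sub
      h4).const_smul β)
  have h2 := (h.workers_moments ((h.memLp (k + 1)).2.2.1 j) hG).2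
  simp only [norm_sub_rev (G (k + 1) j _)] at h2
  have h3 : ∀ ω, M (k + 1) j ω - G k j ω =
      (M k j ω - G k j ω + β • (gradient (localLoss D F j) (W (k + 1) ω) - M k j ω)) +
        β • noise D F ξ W k j ω := by
    intro ω
    rw [h.M_succ_eq]
    module
  rw [integral_const_mul] at h2
  simp only [h3] at h2
  rw [integral_norm_add_smul_sq hA hZ.1
    (h.integral_inner_noise k j subset_rfl (by simp [Source.time]) hAm hA), mul_add, ← integral_const_mul] at h2
  refine h2.trans (add_le_add ?_ ?_)
  · refine integral_le_four ((hA.integrable_norm_pow (by norm_num)).const_mul _)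
      ((hM.sub hG).integrable_norm_pow (by norm_num))
      ((hX.sub hM).integrable_norm_pow (by norm_num)) (h.integrable_radius_sq k)
      (h.integrable_server_error (k + 1)) fun ω => ?_
    have h4 := contract_add_sq_le (normSeminorm ℝ E) h0 h1 (M k j ω - G k j ω)
      (β • (gradient (localLoss D F j) (W (k + 1) ω) - M k j ω))
    simp only [coe_normSeminorm] at h4
    refine h4.trans ?_
    have h5 := norm_add_three_sq_le (gradient (localLoss D F j) (X k ω) - M k j ω)
      (gradient (localLoss D F j) (X (k + 1) ω) - gradient (localLoss D F j) (X k ω))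
      (gradient (localLoss D F j) (W (k + 1) ω) - gradient (localLoss D F j) (X (k + 1) ω))
    rw [sub_add_sub_cancel', add_comm, sub_add_sub_cancel, norm_sub_rev
      (gradient (localLoss D F j) (W (k + 1) ω)) (gradient (localLoss D F j) (X (k + 1) ω))] at h5
    have h6 := ((h.smooth_local j).norm_gradient_sub_sq_le h.equiv (X (k + 1) ω) (X k ω)).trans
      (mul_le_mul_of_nonneg_left (h.step_le k ω) (by positivity))
    have h7 := (h.smooth_local j).norm_gradient_sub_sq_le h.equiv (X (k + 1) ω) (W (k + 1) ω)
    rw [norm_smul, mul_pow, Real.norm_eq_abs, sq_abs]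
    have h8 : 2 / αD * (β ^ 2 * ‖gradient (localLoss D F j) (W (k + 1) ω) - M k j ω‖ ^ 2) ≤
        2 / αD * (β ^ 2 * (3 * (‖gradient (localLoss D F j) (X k ω) - M k j ω‖ ^ 2 +
          Lj j ^ 2 / ρlo ^ 2 * (γ * dualNorm N (avg fun j => G k j ω)) ^ 2 +
          Lj j ^ 2 / ρlo ^ 2 * N (X (k + 1) ω - W (k + 1) ω) ^ 2))) := by
      gcongr
      linarith
    calc _ ≤ _ := add_le_add_right h8 _
      _ = _ := by ring
  · have h4 : 0 ≤ β ^ 2 * ∫ ω, ‖noise D F ξ W k j ω‖ ^ 2 ∂μ := by positivity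
    have h5 := mul_le_mul_of_nonneg_left hZ.2 (sq_nonneg β)
    nlinarith

theorem Model.integrable_dualNorm_gradient_sq
    (h : Model N ρlo ρhi D F L Lj σ μ θP θD ξ lmo αP αD CP CD β γ X₀ X W M G) (k : ℕ) :
    Integrable (fun ω => dualNorm N (gradient (globalLoss D F) (X k ω)) ^ 2) μ :=
  (h.equiv.memLp_dualNorm (h.smooth.memLp_gradient h.equiv (h.memLp k).1)).integrable_sq

theorem Model.descent_recursion
    (h : Model N ρlo ρhi D F L Lj σ μ θP θD ξ lmo αP αD CP CD β γ X₀ X W M G) (hγ : 0 < γ)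
    {fstar : ℝ} (hf : ∀ X, fstar ≤ globalLoss D F X) (k : ℕ) :
    ∫ ω, globalLoss D F (X (k + 1) ω) ∂μ +
      γ / 8 * ∫ ω, dualNorm N (gradient (globalLoss D F) (X k ω)) ^ 2 ∂μ +
      (1 / (4 * γ) - L / 2) * ∫ ω, (γ * dualNorm N (avg fun j => G k j ω)) ^ 2 ∂μ ≤
    ∫ ω, globalLoss D F (X k ω) ∂μ + 3 / 2 * γ * ρhi ^ 2 *
      (∫ ω, ‖gradient (globalLoss D F) (X k ω) - avg fun j => M k j ω‖ ^ 2 ∂μ +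
        1 / (n : ℝ) * ∑ j, ∫ ω, ‖M k j ω - G k j ω‖ ^ 2 ∂μ) := by
  have hX := h.smooth.memLp_gradient h.equiv (h.memLp k).1
  have hM := memLp_avg (h.memLp k).2.2.1
  have hG := memLp_avg (h.memLp k).2.2.2
  have hi1 := h.smooth.integrable_comp h.equiv hf (h.memLp (k + 1)).1
  have hi2 := h.integrable_dualNorm_gradient_sq k
  have hi3 := h.integrable_radius_sq k
  have hi4 := h.smooth.integrable_comp h.equiv hf (h.memLp k).1
  have hi5 := (h.equiv.memLp_dualNorm (hX.sub hG)).integrable_sq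
  have hi6 : Integrable (fun ω => ‖gradient (globalLoss D F) (X k ω) - avg fun j => M k j ω‖ ^ 2) μ :=
    (hX.sub hM).integrable_norm_pow (by norm_num)
  have hi7 : ∀ j, Integrable (fun ω => ‖M k j ω - G k j ω‖ ^ 2) μ := fun j =>
    (((h.memLp k).2.2.1 j).sub ((h.memLp k).2.2.2 j)).integrable_norm_pow (by norm_num)
  have h1 : ∫ ω, globalLoss D F (X (k + 1) ω) ∂μ ≤
      1 * ∫ ω, globalLoss D F (X k ω) ∂μ +
      3 / 4 * γ * ∫ ω, dualNorm N
        (gradient (globalLoss D F) (X k ω) - avg fun j => G k j ω) ^ 2 ∂μ +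
      (-(γ / 8)) * ∫ ω, dualNorm N (gradient (globalLoss D F) (X k ω)) ^ 2 ∂μ +
      (-(1 / (4 * γ) - L / 2)) * ∫ ω, (γ * dualNorm N (avg fun j => G k j ω)) ^ 2 ∂μ := by
    refine integral_le_four hi1 hi4 hi5 hi2 hi3 fun ω => ?_
    have h2 := h.smooth.lmo_step h.equiv hγ (h.isLMO (X k ω)
      (γ * dualNorm N (avg fun j => G k j ω)) (avg fun j => G k j ω)
      (mul_nonneg hγ.le (h.equiv.dualNorm_nonneg _)))
    rw [← h.run.X_succ] at h2
    linarith
  -- Pass to the Euclidean norm at the price $\bar\rho^2$ and split at the average momentum; the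
  -- factor 2 turns $3/4$ into $3/2$.
  have h2 : ∫ ω, dualNorm N
      (gradient (globalLoss D F) (X k ω) - avg fun j => G k j ω) ^ 2 ∂μ ≤
      2 * ρhi ^ 2 * ∫ ω, ‖gradient (globalLoss D F) (X k ω) - avg fun j => M k j ω‖ ^ 2 ∂μ +
      2 * ρhi ^ 2 * ∫ ω, 1 / (n : ℝ) * ∑ j, ‖M k j ω - G k j ω‖ ^ 2 ∂μ := by
    refine integral_le_two hi5 hi6 ((integrable_finsetSum _ fun j _ => hi7 j).const_mul _)
      fun ω => ?_
    have h3 := pow_le_pow_left₀ (h.equiv.dualNorm_nonneg _) (h.equiv.dualNorm_le_norm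
      (gradient (globalLoss D F) (X k ω) - avg fun j => G k j ω)) 2
    have h4 := parallelogram_law_with_norm ℝ
      (gradient (globalLoss D F) (X k ω) - avg fun j => M k j ω)
      ((avg fun j => M k j ω) - avg fun j => G k j ω)
    have h5 := norm_avg_sq_le fun j => M k j ω - G k j ω
    rw [avg_sub] at h5
    rw [sub_add_sub_cancel] at h4
    refine h3.trans ?_
    rw [mul_pow, ← mul_add, mul_comm 2 (ρhi ^ 2), mul_assoc]
    refine mul_le_mul_of_nonneg_left ?_ (sq_nonneg _)
    nlinarith [sq_nonneg ‖gradient (globalLoss D F) (X k ω) - (avg fun j => M k j ω) -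
      ((avg fun j => M k j ω) - avg fun j => G k j ω)‖]
  rw [integral_const_mul, integral_finsetSum _ fun j _ => hi7 j] at h2
  have h3 := mul_le_mul_of_nonneg_left h2 (by positivity : 0 ≤ 3 / 4 * γ)
  linarith

end Run

/-! ### Summing the recursions -/

section Summation

open Finset

theorem contraction_sum_le {x y : ℕ → ℝ} {a : ℝ} (hx : ∀ k, 0 ≤ x k)
    (h : ∀ k, x (k + 1) ≤ (1 - a) * x k + y k) (K : ℕ) :
    a * ∑ k ∈ range K, x k ≤ x 0 + ∑ k ∈ range K, y k := by
  suffices h1 : x K + a * ∑ k ∈ range K, x k ≤ x 0 + ∑ k ∈ range K, y k by linarith [hx K]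
  induction K with
  | zero => simp
  | succ K ih =>
    rw [sum_range_succ, sum_range_succ, mul_add]
    linarith [h K]

/-- The other recursions involve the lag at $k+1$, so the shifted sum is needed; $X^0=W^0$ removes
the initial term. -/
theorem shifted_contraction_sum_le {v y : ℕ → ℝ} {a : ℝ} (ha : a ≤ 1) (hv : ∀ k, 0 ≤ v k)
    (hv0 : v 0 = 0) (h : ∀ k, v (k + 1) ≤ (1 - a) * v k + y k) (K : ℕ) :
    a * ∑ k ∈ range K, v (k + 1) ≤ ∑ k ∈ range K, y k := by
  have h1 := sum_le_sum fun k (_ : k ∈ range K) => h k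
  rw [sum_add_distrib, ← mul_sum] at h1
  have h2 := sum_range_succ' v K
  rw [sum_range_succ] at h2
  have h3 : ∑ k ∈ range K, v k ≤ ∑ k ∈ range K, v (k + 1) := by linarith [hv K]
  linarith [mul_le_mul_of_nonneg_left h3 (sub_nonneg.2 ha)]

theorem average_le {n : ℕ} (hn : 0 < n) {x y z w : Fin n → ℝ} {a b c e : ℝ}
    (h : ∀ j, x j ≤ a * y j + b * z j + c * w j + e) :
    1 / (n : ℝ) * ∑ j, x j ≤ a * (1 / (n : ℝ) * ∑ j, y j) + b * (1 / (n : ℝ) * ∑ j, z j) +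
      c * (1 / (n : ℝ) * ∑ j, w j) + e := by
  have hn' : (0 : ℝ) < n := by exact_mod_cast hn
  have h1 := sum_le_sum fun j (_ : j ∈ univ) => h j
  simp only [sum_add_distrib, ← mul_sum, sum_const, card_univ, Fintype.card_fin,
    nsmul_eq_mul] at h1
  calc _ ≤ _ := mul_le_mul_of_nonneg_left h1 (by positivity)
    _ = _ := by field_simp

/-- Summation of the recursions for the compression errors `v` and `d`, the momentum errors `p`
and `q`, the squared radii `τ`, the squared gradient norms `g` and the function values `φ`. -/
theorem sum_gradient_le {ρlo ρhi αP αD β γ L Lt s : ℝ} {n : ℕ} (hlo : 0 < ρlo) (hP0 : 0 < αP)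
    (hP1 : αP ≤ 1) (hD0 : 0 < αD) (hβ0 : 0 < β) (hγ : 0 < γ)
    (hζ : 3 / 2 * γ * (zeta ρlo ρhi αP αD β L Lt / 3) ≤ 1 / (4 * γ) - L / 2)
    {v p q d τ g φ : ℕ → ℝ} (hv : ∀ k, 0 ≤ v k) (hp : ∀ k, 0 ≤ p k) (hq : ∀ k, 0 ≤ q k)
    (hd : ∀ k, 0 ≤ d k) (hτ : ∀ k, 0 ≤ τ k) (hv0 : v 0 = 0) {fstar : ℝ} (hf : ∀ k, fstar ≤ φ k)
    (hv' : ∀ k, v (k + 1) ≤ (1 - αP / 2) * v k + 2 / αP * τ k)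
    (hp' : ∀ k, p (k + 1) ≤ (1 - β) * p k + 2 / β * (L ^ 2 / ρlo ^ 2 * τ k) +
      2 * β * (L ^ 2 / ρlo ^ 2 * v (k + 1)) + β ^ 2 * (s / n))
    (hq' : ∀ k, q (k + 1) ≤ (1 - β) * q k + 2 / β * (Lt ^ 2 / ρlo ^ 2 * τ k) +
      2 * β * (Lt ^ 2 / ρlo ^ 2 * v (k + 1)) + β ^ 2 * s)
    (hd' : ∀ k, d (k + 1) ≤ (1 - αD / 2) * d k + 6 / αD * β ^ 2 * q k +
      6 / αD * β ^ 2 * (Lt ^ 2 / ρlo ^ 2) * τ k +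
      6 / αD * β ^ 2 * (Lt ^ 2 / ρlo ^ 2) * v (k + 1) + β ^ 2 * s)
    (hφ : ∀ k, φ (k + 1) + γ / 8 * g k + (1 / (4 * γ) - L / 2) * τ k ≤
      φ k + 3 / 2 * γ * ρhi ^ 2 * (p k + d k)) (K : ℕ) :
    γ / 8 * ∑ k ∈ range K, g k ≤ φ 0 - fstar + 3 / 2 * γ * ρhi ^ 2 *
      (p 0 / β + 2 * d 0 / αD + 12 * β / αD ^ 2 * q 0 +
        K * s * (β / n + 12 * β ^ 3 / αD ^ 2 + 2 * β ^ 2 / αD)) := by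
  have hT : 0 ≤ ∑ k ∈ range K, τ k := sum_nonneg fun k _ => hτ k
  have eφ : γ / 8 * ∑ k ∈ range K, g k + (1 / (4 * γ) - L / 2) * ∑ k ∈ range K, τ k ≤
      φ 0 - fstar + 3 / 2 * γ * ρhi ^ 2 * (∑ k ∈ range K, p k + ∑ k ∈ range K, d k) := by
    have h1 := sum_le_sum fun k (_ : k ∈ range K) => hφ k
    simp only [sum_add_distrib, ← mul_sum] at h1
    have h2 := sum_range_sub φ K
    rw [sum_sub_distrib] at h2
    linarith [hf K]
  have eV := shifted_contraction_sum_le (by linarith) hv hv0 hv' K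
  have eP := contraction_sum_le hp (a := β) (y := fun k => 2 / β * (L ^ 2 / ρlo ^ 2 * τ k) +
      2 * β * (L ^ 2 / ρlo ^ 2 * v (k + 1)) + β ^ 2 * (s / n)) (fun k => by linarith [hp' k]) K
  have eQ := contraction_sum_le hq (a := β) (y := fun k => 2 / β * (Lt ^ 2 / ρlo ^ 2 * τ k) +
      2 * β * (Lt ^ 2 / ρlo ^ 2 * v (k + 1)) + β ^ 2 * s) (fun k => by linarith [hq' k]) K
  have eD := contraction_sum_le hd (a := αD / 2) (y := fun k => 6 / αD * β ^ 2 * q k +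
      6 / αD * β ^ 2 * (Lt ^ 2 / ρlo ^ 2) * τ k +
      6 / αD * β ^ 2 * (Lt ^ 2 / ρlo ^ 2) * v (k + 1) + β ^ 2 * s)
      (fun k => by linarith [hd' k]) K
  simp only [sum_add_distrib, ← mul_sum, sum_const, card_range, nsmul_eq_mul] at eV eP eQ eD
  generalize ∑ k ∈ range K, τ k = T at *
  generalize ∑ k ∈ range K, v (k + 1) = V at *
  generalize ∑ k ∈ range K, p k = P at *
  generalize ∑ k ∈ range K, q k = Q at *
  generalize ∑ k ∈ range K, d k = Δ at *
  have hV : V ≤ 4 / αP ^ 2 * T := by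
    have h1 := mul_le_mul_of_nonneg_left eV (by positivity : 0 ≤ 2 / αP)
    calc V = 2 / αP * (αP / 2 * V) := by field_simp
      _ ≤ _ := h1
      _ = _ := by ring
  -- Shared by the global momentum error ($c=s/n$) and the averaged local one ($c=s$).
  have momentum : ∀ {x0 x ℓ c : ℝ}, 0 ≤ ℓ →
      β * x ≤ x0 + (2 / β * (ℓ * T) + 2 * β * (ℓ * V) + β ^ 2 * (K * c)) →
      x ≤ x0 / β + ℓ * (2 / β ^ 2 + 8 / αP ^ 2) * T + K * β * c := by
    intro x0 x ℓ c hℓ h1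
    have h2 : 2 * β * (ℓ * V) ≤ 2 * β * (ℓ * (4 / αP ^ 2 * T)) := by gcongr
    calc x = β⁻¹ * (β * x) := by field_simp
      _ ≤ β⁻¹ * (x0 + (2 / β * (ℓ * T) + 2 * β * (ℓ * (4 / αP ^ 2 * T)) + β ^ 2 * (K * c))) := by
        gcongr
        linarith
      _ = _ := by
        field_simp
        ring
  have hPb := momentum (ℓ := L ^ 2 / ρlo ^ 2) (by positivity) eP
  have hQb := momentum (ℓ := Lt ^ 2 / ρlo ^ 2) (by positivity) eQ
  have hDb : Δ ≤ 2 * d 0 / αD + 12 * β ^ 2 / αD ^ 2 *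
      (q 0 / β + Lt ^ 2 / ρlo ^ 2 * (2 / β ^ 2 + 8 / αP ^ 2) * T + K * β * s +
        Lt ^ 2 / ρlo ^ 2 * (1 + 4 / αP ^ 2) * T) + 2 * K * β ^ 2 * s / αD := by
    have h2 : 6 / αD * β ^ 2 * (Lt ^ 2 / ρlo ^ 2) * V ≤
        6 / αD * β ^ 2 * (Lt ^ 2 / ρlo ^ 2) * (4 / αP ^ 2 * T) := by gcongr
    have h3 := mul_le_mul_of_nonneg_left hQb (by positivity : 0 ≤ 6 / αD * β ^ 2)
    calc Δ = 2 / αD * (αD / 2 * Δ) := by field_simp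
      _ ≤ 2 / αD * (d 0 + (6 / αD * β ^ 2 * (q 0 / β +
          Lt ^ 2 / ρlo ^ 2 * (2 / β ^ 2 + 8 / αP ^ 2) * T + K * β * s) +
          6 / αD * β ^ 2 * (Lt ^ 2 / ρlo ^ 2) * T +
          6 / αD * β ^ 2 * (Lt ^ 2 / ρlo ^ 2) * (4 / αP ^ 2 * T) + K * (β ^ 2 * s))) := by
        gcongr
        linarith
      _ = _ := by ring
  -- The left side is $\bar\rho^2$ times the total coefficient of $T$ collected from `hPb` and
  -- `hDb`; the prescribed $\zeta/3$ exceeds it by an explicit nonnegative quantity.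
  have key : ρhi ^ 2 * (L ^ 2 / ρlo ^ 2 * (2 / β ^ 2 + 8 / αP ^ 2) +
      12 * β ^ 2 / αD ^ 2 * (Lt ^ 2 / ρlo ^ 2 * (2 / β ^ 2 + 8 / αP ^ 2) +
        Lt ^ 2 / ρlo ^ 2 * (1 + 4 / αP ^ 2))) ≤ zeta ρlo ρhi αP αD β L Lt / 3 := by
    have h1 : zeta ρlo ρhi αP αD β L Lt / 3 - ρhi ^ 2 *
        (L ^ 2 / ρlo ^ 2 * (2 / β ^ 2 + 8 / αP ^ 2) +
        12 * β ^ 2 / αD ^ 2 * (Lt ^ 2 / ρlo ^ 2 * (2 / β ^ 2 + 8 / αP ^ 2) +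
        Lt ^ 2 / ρlo ^ 2 * (1 + 4 / αP ^ 2))) =
        ρhi ^ 2 / ρlo ^ 2 * (2 / β ^ 2 * L ^ 2 + (8 * β + 8) / αP ^ 2 * L ^ 2 +
          24 / αD ^ 2 * Lt ^ 2 + 48 * β ^ 2 * (2 * β + 2) / (αP ^ 2 * αD ^ 2) * Lt ^ 2) := by
      rw [zeta]
      field_simp
      ring
    have h2 : 0 ≤ ρhi ^ 2 / ρlo ^ 2 * (2 / β ^ 2 * L ^ 2 + (8 * β + 8) / αP ^ 2 * L ^ 2 +
          24 / αD ^ 2 * Lt ^ 2 + 48 * β ^ 2 * (2 * β + 2) / (αP ^ 2 * αD ^ 2) * Lt ^ 2) := by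
      positivity
    linarith
  have h1 := mul_le_mul_of_nonneg_left (mul_le_mul_of_nonneg_left key
    (by positivity : 0 ≤ 3 / 2 * γ)) hT
  have h2 := mul_le_mul_of_nonneg_left hζ hT
  have h3 := mul_le_mul_of_nonneg_left (add_le_add hPb hDb)
    (by positivity : 0 ≤ 3 / 2 * γ * ρhi ^ 2)
  have h4 : 12 * β ^ 2 / αD ^ 2 * (q 0 / β) = 12 * β / αD ^ 2 * q 0 := by field_simp
  have h5 : 12 * β ^ 2 / αD ^ 2 * (K * β * s) = K * s * (12 * β ^ 3 / αD ^ 2) := by ring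
  have h6 : K * β * (s / n) = K * s * (β / n) := by ring
  have h7 : 2 * K * β ^ 2 * s / αD = K * s * (2 * β ^ 2 / αD) := by ring
  rw [h6, h7, mul_add (12 * β ^ 2 / αD ^ 2), mul_add (12 * β ^ 2 / αD ^ 2),
    mul_add (12 * β ^ 2 / αD ^ 2), h4, h5] at h3
  linarith

end Summation

/-! ### The stepsize -/

section Parameters

theorem quadMean_sq {n : ℕ} (Lj : Fin n → ℝ) :
    quadMean Lj ^ 2 = 1 / (n : ℝ) * ∑ j, Lj j ^ 2 := Real.sq_sqrt (by positivity)

theorem zeta_nonneg (ρlo ρhi αP αD L Lt : ℝ) {β : ℝ} (hβ : 0 < β) :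
    0 ≤ zeta ρlo ρhi αP αD β L Lt := by
  unfold zeta
  positivity

/-- With $s=\sqrt{2\zeta}$ the right side is exactly $s/4$ and the left side is $\gamma s^2/4$, so
$\gamma s\le1$ suffices. -/
theorem stepsize_condition {ζ L γ : ℝ} (hζ : 0 ≤ ζ) (hL : 0 ≤ L) (hγ0 : 0 < γ)
    (hγ : γ = 1 / (Real.sqrt (2 * ζ) + 2 * L)) :
    3 / 2 * γ * (ζ / 3) ≤ 1 / (4 * γ) - L / 2 := by
  have h1 := Real.sqrt_nonneg (2 * ζ)
  have h2 := Real.sq_sqrt (by positivity : 0 ≤ 2 * ζ)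
  generalize Real.sqrt (2 * ζ) = s at *
  have h3 : γ * (s + 2 * L) = 1 := by
    rw [hγ, one_div, inv_mul_cancel₀]
    intro h
    rw [h] at hγ
    simp [hγ] at hγ0
  have h4 : 1 / (4 * γ) = (s + 2 * L) / 4 := by
    field_simp
    linarith
  have h5 : γ * s ≤ 1 := by nlinarith [mul_nonneg hγ0.le hL]
  rw [h4]
  nlinarith

theorem inv_stepsize_le {ρlo ρhi αP αD β L Lt γ : ℝ} (hlo : 0 < ρlo) (hρ : ρlo ≤ ρhi)
    (hP0 : 0 < αP) (hP1 : αP ≤ 1) (hD0 : 0 < αD) (hD1 : αD ≤ 1) (hβ0 : 0 < β) (hβ1 : β ≤ 1)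
    (hL : 0 ≤ L) (hLt : L ≤ Lt)
    (hγ : γ = 1 / (Real.sqrt (2 * zeta ρlo ρhi αP αD β L Lt) + 2 * L)) :
    γ⁻¹ ≤ 53 * (ρhi ^ 2 * L / (ρlo ^ 2 * β) + ρhi ^ 2 * Lt / (ρlo ^ 2 * αP * αD)) := by
  have hLt0 := hL.trans hLt
  have hr : 1 ≤ ρhi ^ 2 / ρlo ^ 2 := by
    rw [one_le_div (by positivity)]
    gcongr
  have hx : ρhi ^ 2 * L / (ρlo ^ 2 * β) + ρhi ^ 2 * Lt / (ρlo ^ 2 * αP * αD) =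
      ρhi ^ 2 / ρlo ^ 2 * (L / β + Lt / (αP * αD)) := by
    field_simp
  have hLx : L ≤ L / β := le_div_self hL hβ0 hβ1
  have hy1 : Lt / αP ≤ Lt / (αP * αD) := by
    gcongr
    exact mul_le_of_le_one_right hP0.le hD1
  have hy2 : Lt / αD ≤ Lt / (αP * αD) := by
    gcongr
    exact mul_le_of_le_one_left hD0.le hP1
  have hz : zeta ρlo ρhi αP αD β L Lt = ρhi ^ 2 / ρlo ^ 2 * (12 * (L / β) ^ 2 +
      24 * (β + 2) * (L / αP) ^ 2 + 36 * (β ^ 2 + 4) * (Lt / αD) ^ 2 +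
      144 * (β ^ 2 * (2 * β + 5)) * (Lt / (αP * αD)) ^ 2) := by
    rw [zeta]
    field_simp
  have hβ2 : β ^ 2 ≤ 1 := pow_le_one₀ hβ0.le hβ1
  -- The constant comes from $2\cdot1260\le51^2$, where $1260=72+180+1008$; the remaining $2L$ of
  -- $\gamma^{-1}$ makes it 53.
  have hs : Real.sqrt (2 * zeta ρlo ρhi αP αD β L Lt) ≤
      51 * (ρhi ^ 2 / ρlo ^ 2 * (L / β + Lt / (αP * αD))) := by
    refine Real.sqrt_le_iff.2 ⟨by positivity, ?_⟩
    have h1 : zeta ρlo ρhi αP αD β L Lt ≤ ρhi ^ 2 / ρlo ^ 2 * (12 * (L / β) ^ 2 +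
      24 * (1 + 2) * (Lt / (αP * αD)) ^ 2 + 36 * (1 + 4) * (Lt / (αP * αD)) ^ 2 +
      144 * (1 * (2 * 1 + 5)) * (Lt / (αP * αD)) ^ 2) := by
      rw [hz]
      have h2 : L / αP ≤ Lt / (αP * αD) := (div_le_div_of_nonneg_right hLt hP0.le).trans hy1
      gcongr
    have hx0 : 0 ≤ L / β := by positivity
    have hy0 : 0 ≤ Lt / (αP * αD) := by positivity
    generalize L / β = x at *
    generalize Lt / (αP * αD) = y at *
    generalize ρhi ^ 2 / ρlo ^ 2 = r at *
    have h2 : r * (12 * x ^ 2 + 1260 * y ^ 2) ≤ r * (1260 * (x + y) ^ 2) := by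
      gcongr
      nlinarith [mul_nonneg hx0 hy0]
    -- Since $r\ge1$, it may be squared; this gives the factor $r=\bar\rho^2/\underline\rho^2$
    -- outside the root.
    have h3 : r * (x + y) ^ 2 ≤ r ^ 2 * (x + y) ^ 2 := by
      gcongr
      nlinarith
    nlinarith [sq_nonneg (x + y), sq_nonneg r, mul_nonneg (sq_nonneg r) (sq_nonneg (x + y))]
  rw [hγ, one_div, inv_inv, hx]
  have h4 : L ≤ ρhi ^ 2 / ρlo ^ 2 * (L / β + Lt / (αP * αD)) := by
    have : 0 ≤ Lt / (αP * αD) := by positivity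
    nlinarith
  linarith

end Parameters

/-! ### The momentum parameter and the rate -/

section Rate

theorem le_rpow_div_of_pow_le {x u : ℝ} (hx : 0 ≤ x) (hu : 0 ≤ u) {m k : ℕ} (hm : m ≠ 0)
    (h : x ^ m ≤ u ^ k) : x ≤ u ^ ((k : ℝ) / m) := by
  rw [div_eq_mul_inv, Real.rpow_mul hu, Real.rpow_natCast]
  calc x = (x ^ m) ^ ((m : ℝ)⁻¹) := (Real.pow_rpow_inv_natCast hx hm).symm
    _ ≤ _ := Real.rpow_le_rpow (by positivity) h (by positivity)

theorem rpow_one_div_pow {x : ℝ} (hx : 0 ≤ x) {m : ℕ} (hm : m ≠ 0) :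
    (x ^ (1 / (m : ℝ))) ^ m = x := by
  rw [one_div]
  exact Real.rpow_inv_natCast_pow hx hm

theorem momentumChoice_le_one (Ψ L ρlo σ αD : ℝ) (n K : ℕ) :
    momentumChoice Ψ L ρlo σ αD n K ≤ 1 := by
  unfold momentumChoice
  split_ifs
  · exact le_rfl
  · exact min_le_left _ _

/-- Trades real powers for polynomial relations: two upper bounds from the minimum, and the equation
for the entry that attains it. -/
theorem momentumChoice_spec {Ψ L ρlo σ αD : ℝ} {n K : ℕ} (hΨ : 0 ≤ Ψ) (hL : 0 ≤ L)
    (hD : 0 < αD) (hσ : σ ≠ 0) {a : ℝ} (ha : a = Ψ * L / (ρlo ^ 2 * σ ^ 2 * K)) {β : ℝ}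
    (hβ0 : 0 < β) (hβ : β = momentumChoice Ψ L ρlo σ αD n K) :
    β ^ 2 ≤ a * n ∧ β ^ 3 ≤ a * αD ∧
      (β = 1 ∨ β ^ 2 = a * n ∨ β ^ 3 = a * αD ∨ β ^ 4 = a * αD ^ 2) := by
  have ha0 : 0 ≤ a := by
    rw [ha]
    positivity
  have h2 : Ψ * L * n / (ρlo ^ 2 * σ ^ 2 * K) = a * n := by rw [ha]; ring
  have h3 : Ψ * L * αD / (ρlo ^ 2 * σ ^ 2 * K) = a * αD := by rw [ha]; ring
  have h4 : Ψ * L * αD ^ 2 / (ρlo ^ 2 * σ ^ 2 * K) = a * αD ^ 2 := by rw [ha]; ring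
  rw [momentumChoice, if_neg hσ, h2, h3, h4] at hβ
  have e2 := rpow_one_div_pow (m := 2) (by positivity : 0 ≤ a * n) two_ne_zero
  have e3 := rpow_one_div_pow (m := 3) (by positivity : 0 ≤ a * αD) three_ne_zero
  have e4 := rpow_one_div_pow (m := 4) (by positivity : 0 ≤ a * αD ^ 2) four_ne_zero
  push_cast at e2 e3 e4
  refine ⟨?_, ?_, ?_⟩
  · rw [← e2]
    exact pow_le_pow_left₀ hβ0.le (hβ.le.trans ((min_le_right _ _).trans (min_le_left _ _))) 2
  · rw [← e3]
    exact pow_le_pow_left₀ hβ0.le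
      (hβ.le.trans ((min_le_right _ _).trans ((min_le_right _ _).trans (min_le_left _ _)))) 3
  · rcases min_choice (1 : ℝ) _ with h | h <;> rw [h] at hβ
    · exact .inl hβ
    rcases min_choice ((a * n) ^ (1 / 2 : ℝ)) _ with h | h <;> rw [h] at hβ
    · exact .inr (.inl (by rw [hβ, e2]))
    rcases min_choice ((a * αD) ^ (1 / 3 : ℝ)) _ with h | h <;> rw [h] at hβ
    · exact .inr (.inr (.inl (by rw [hβ, e3])))
    · exact .inr (.inr (.inr (by rw [hβ, e4])))

theorem rate_nonneg {Ψ L Lt ρlo ρhi σ αP αD : ℝ} {n K : ℕ} (hΨ : 0 ≤ Ψ) (hL : 0 ≤ L)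
    (hLt : L ≤ Lt) (hlo : 0 < ρlo) (hhi : 0 < ρhi) (hσ : 0 ≤ σ) (hP0 : 0 < αP) (hD0 : 0 < αD) :
    0 ≤ rate Ψ L Lt ρlo ρhi σ αP αD n K := by
  have := hL.trans hLt
  unfold rate
  positivity

/-- Of the fourth rate term only nonnegativity is used: the $\beta^3$ noise is already dominated by
the first rate term. The largest coefficient to be covered by 1000 is that of the first term,
$424+424+144=992$. -/
theorem le_rate {Ψ L Lt ρlo ρhi σ αP αD β : ℝ} {n K : ℕ} (hΨ : 0 ≤ Ψ) (hL : 0 ≤ L)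
    (hLt : L ≤ Lt) (hlo : 0 < ρlo) (hhi : 0 < ρhi) (hσ : 0 ≤ σ) (hP0 : 0 < αP) (hP1 : αP ≤ 1)
    (hD0 : 0 < αD) (hD1 : αD ≤ 1) (hn : 0 < n) (hK : 0 < K) (hβ0 : 0 < β)
    (hβ : β = momentumChoice Ψ L ρlo σ αD n K) :
    8 * (53 * (ρhi ^ 2 * L / (ρlo ^ 2 * β) + ρhi ^ 2 * Lt / (ρlo ^ 2 * αP * αD))) * Ψ / K +
      12 * ρhi ^ 2 * σ ^ 2 * (β / n + 12 * β ^ 3 / αD ^ 2 + 2 * β ^ 2 / αD) ≤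
      1000 * rate Ψ L Lt ρlo ρhi σ αP αD n K := by
  have hLt0 := hL.trans hLt
  have hn' : (0 : ℝ) < n := by exact_mod_cast hn
  have hK' : (0 : ℝ) < K := by exact_mod_cast hK
  have h4 : 0 ≤ (Ψ * ρlo ^ (8 / 3 : ℝ) * σ ^ (2 / 3 : ℝ) * L
        / (ρhi ^ 2 * αD ^ (2 / 3 : ℝ) * K)) ^ (3 / 4 : ℝ) := by positivity
  have h2 : 0 ≤ (Ψ * ρhi ^ 4 * σ ^ 2 * L / (ρlo ^ 2 * n * K)) ^ (1 / 2 : ℝ) := by positivity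
  have h3 : 0 ≤ (Ψ * ρhi ^ 3 * σ * L / (ρlo ^ 2 * Real.sqrt αD * K)) ^ (2 / 3 : ℝ) := by
    positivity
  have h1 : 0 ≤ Ψ * ρhi ^ 2 * Lt / (ρlo ^ 2 * αP * αD * K) := by positivity
  have e1 : 8 * (53 * (ρhi ^ 2 * L / (ρlo ^ 2 * β) + ρhi ^ 2 * Lt / (ρlo ^ 2 * αP * αD))) * Ψ / K =
      424 * (Ψ * ρhi ^ 2 * L / (ρlo ^ 2 * β * K)) +
        424 * (Ψ * ρhi ^ 2 * Lt / (ρlo ^ 2 * αP * αD * K)) := by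
    field_simp
    ring
  have e2 : 12 * ρhi ^ 2 * σ ^ 2 * (β / n + 12 * β ^ 3 / αD ^ 2 + 2 * β ^ 2 / αD) =
      12 * (ρhi ^ 2 * σ ^ 2 * β / n) + 144 * (ρhi ^ 2 * σ ^ 2 * β ^ 3 / αD ^ 2) +
        24 * (ρhi ^ 2 * σ ^ 2 * β ^ 2 / αD) := by ring
  rw [e1, e2]
  have f1 : Ψ * ρhi ^ 2 * L / (ρlo ^ 2 * αD * K) ≤
      Ψ * ρhi ^ 2 * Lt / (ρlo ^ 2 * αP * αD * K) := by
    gcongr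
    exact mul_le_of_le_one_right (by positivity) hP1
  have f1' : Ψ * ρhi ^ 2 * L / (ρlo ^ 2 * K) ≤ Ψ * ρhi ^ 2 * L / (ρlo ^ 2 * αD * K) := by
    gcongr
    exact mul_le_of_le_one_right (by positivity) hD1
  rcases hσ.eq_or_lt with h0 | h0
  · have hβ1 : β = 1 := by rw [hβ, momentumChoice, if_pos h0.symm]
    have z0 : Ψ * ρhi ^ 2 * L / (ρlo ^ 2 * β * K) = Ψ * ρhi ^ 2 * L / (ρlo ^ 2 * K) := by
      rw [hβ1, mul_one]
    have z1 : ρhi ^ 2 * σ ^ 2 * β / n = 0 := by simp [← h0]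
    have z2 : ρhi ^ 2 * σ ^ 2 * β ^ 2 / αD = 0 := by simp [← h0]
    have z3 : ρhi ^ 2 * σ ^ 2 * β ^ 3 / αD ^ 2 = 0 := by simp [← h0]
    unfold rate
    linarith
  · obtain ⟨b2, b3, hb⟩ := momentumChoice_spec hΨ hL hD0 h0.ne' rfl hβ0 hβ
    have ha : Ψ * L / (ρlo ^ 2 * K) = Ψ * L / (ρlo ^ 2 * σ ^ 2 * K) * σ ^ 2 := by field_simp
    set a := Ψ * L / (ρlo ^ 2 * σ ^ 2 * K) with ha'
    have ha0 : 0 ≤ a := by positivity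
    have n2 : ρhi ^ 2 * σ ^ 2 * β / n ≤
        (Ψ * ρhi ^ 4 * σ ^ 2 * L / (ρlo ^ 2 * n * K)) ^ (1 / 2 : ℝ) := by
      have := le_rpow_div_of_pow_le (x := ρhi ^ 2 * σ ^ 2 * β / n)
        (u := Ψ * ρhi ^ 4 * σ ^ 2 * L / (ρlo ^ 2 * n * K)) (m := 2) (k := 1)
        (by positivity) (by positivity) two_ne_zero ?_
      · exact_mod_cast this
      · calc (ρhi ^ 2 * σ ^ 2 * β / n) ^ 2 = ρhi ^ 4 * σ ^ 4 / n ^ 2 * β ^ 2 := by ring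
          _ ≤ ρhi ^ 4 * σ ^ 4 / n ^ 2 * (a * n) := by gcongr
          _ = ρhi ^ 4 * σ ^ 2 / n * (a * σ ^ 2) := by field_simp
          _ = _ := by
            rw [← ha]
            field_simp
    have n3 : ρhi ^ 2 * σ ^ 2 * β ^ 2 / αD ≤
        (Ψ * ρhi ^ 3 * σ * L / (ρlo ^ 2 * Real.sqrt αD * K)) ^ (2 / 3 : ℝ) := by
      have := le_rpow_div_of_pow_le (x := ρhi ^ 2 * σ ^ 2 * β ^ 2 / αD)
        (u := Ψ * ρhi ^ 3 * σ * L / (ρlo ^ 2 * Real.sqrt αD * K)) (m := 3) (k := 2)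
        (by positivity) (by positivity) three_ne_zero ?_
      · exact_mod_cast this
      · calc (ρhi ^ 2 * σ ^ 2 * β ^ 2 / αD) ^ 3 = ρhi ^ 6 * σ ^ 6 / αD ^ 3 * (β ^ 3) ^ 2 := by ring
          _ ≤ ρhi ^ 6 * σ ^ 6 / αD ^ 3 * (a * αD) ^ 2 := by gcongr
          _ = ρhi ^ 6 * σ ^ 2 / αD * (a * σ ^ 2) ^ 2 := by field_simp
          _ = _ := by
            rw [← ha, div_pow _ (ρlo ^ 2 * Real.sqrt αD * K), mul_pow (ρlo ^ 2 * Real.sqrt αD),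
              mul_pow (ρlo ^ 2), Real.sq_sqrt hD0.le]
            field_simp
    -- The cube-root entry of the minimum gives $\beta^3\le a\alpha_D$, which is enough here;
    -- $L\le\tilde L$ and $\alpha_P\le1$ then lead to the first rate term.
    have n4 : ρhi ^ 2 * σ ^ 2 * β ^ 3 / αD ^ 2 ≤ Ψ * ρhi ^ 2 * L / (ρlo ^ 2 * αD * K) := by
      calc ρhi ^ 2 * σ ^ 2 * β ^ 3 / αD ^ 2 ≤ ρhi ^ 2 * σ ^ 2 * (a * αD) / αD ^ 2 := by gcongr
        _ = ρhi ^ 2 / αD * (a * σ ^ 2) := by field_simp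
        _ = _ := by
          rw [← ha]
          field_simp
    have ho : Ψ * ρhi ^ 2 * L / (ρlo ^ 2 * β * K) = ρhi ^ 2 * σ ^ 2 * (a / β) := by
      calc _ = ρhi ^ 2 / β * (Ψ * L / (ρlo ^ 2 * K)) := by field_simp
        _ = _ := by
          rw [ha]
          ring
    have n1 : Ψ * ρhi ^ 2 * L / (ρlo ^ 2 * β * K) ≤
        Ψ * ρhi ^ 2 * Lt / (ρlo ^ 2 * αP * αD * K) +
        (Ψ * ρhi ^ 4 * σ ^ 2 * L / (ρlo ^ 2 * n * K)) ^ (1 / 2 : ℝ) +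
        (Ψ * ρhi ^ 3 * σ * L / (ρlo ^ 2 * Real.sqrt αD * K)) ^ (2 / 3 : ℝ) := by
      -- An attained entry below 1 turns $a/\beta$ into $\beta/n$, $\beta^2/\alpha_D$ or
      -- $\beta^3/\alpha_D^2$, so the optimization term equals a noise term bounded above.
      rcases hb with hb | hb | hb | hb
      · rw [hb, mul_one]
        linarith
      · have : a / β = β / n := by
          field_simp
          linarith
        rw [ho, this, ← mul_div_assoc]
        linarith
      · have : a / β = β ^ 2 / αD := by
          field_simp
          linarith
        rw [ho, this, ← mul_div_assoc]
        linarith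
      · have : a / β = β ^ 3 / αD ^ 2 := by
          field_simp
          linarith
        rw [ho, this, ← mul_div_assoc]
        linarith
    unfold rate
    linarith

end Rate

/-! ### Assembling the convergence bound -/

section Convergence

variable {E : Type*} [NormedAddCommGroup E] [InnerProductSpace ℝ E] [CompleteSpace E]
  [MeasurableSpace E] [BorelSpace E] [SecondCountableTopology E] {n : ℕ} {Ξ : Fin n → Type*}
  [∀ j, MeasurableSpace (Ξ j)] {Ω ΘP ΘD : Type*} [MeasurableSpace Ω] [MeasurableSpace ΘP]
  [MeasurableSpace ΘD]
  {N : Seminorm ℝ E} {ρlo ρhi : ℝ} {D : ∀ j, Measure (Ξ j)} {F : ∀ j, E → Ξ j → ℝ}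
  {L : ℝ} {Lj : Fin n → ℝ} {σ : ℝ} {μ : Measure Ω} [IsProbabilityMeasure μ] {θP : ℕ → Ω → ΘP}
  {θD : ℕ → Ω → ΘD} {ξ : ℕ → ∀ j, Ω → Ξ j} {lmo : E → ℝ → E → E} {αP αD : ℝ}
  {CP : ℕ → ΘP → E → E} {CD : ℕ → Fin n → ΘD → E → E} {β γ : ℝ} {X₀ : E} {X W : ℕ → Ω → E}
  {M G : ℕ → Fin n → Ω → E}

omit [BorelSpace E] [SecondCountableTopology E] [IsProbabilityMeasure μ] in
theorem Model.psiZero_nonneg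
    (h : Model N ρlo ρhi D F L Lj σ μ θP θD ξ lmo αP αD CP CD β γ X₀ X W M G)
    {fstar : ℝ} (hf : ∀ X, fstar ≤ globalLoss D F X) :
    0 ≤ psiZero μ D F fstar ρhi αD β γ X₀ (M 0) (G 0) := by
  have h0 := h.beta_pos
  have h1 := h.gamma_nonneg
  have h2 := (h.workers 0 ⟨0, h.card_pos⟩).pos
  have h3 := sub_nonneg.2 (hf X₀)
  have h4 : ∀ Y : Ω → E, 0 ≤ ∫ ω, ‖Y ω‖ ^ 2 ∂μ := fun Y => integral_nonneg fun _ => by positivity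
  unfold psiZero
  have h5 := h4 fun ω => gradient (globalLoss D F) X₀ - avg (fun j => M 0 j ω)
  have h6 := Finset.sum_nonneg fun j (_ : j ∈ Finset.univ) =>
    h4 fun ω => gradient (localLoss D F j) X₀ - M 0 j ω
  have h7 := Finset.sum_nonneg fun j (_ : j ∈ Finset.univ) => h4 fun ω => M 0 j ω - G 0 j ω
  positivity

theorem Model.sum_dualNorm_gradient_le
    (h : Model N ρlo ρhi D F L Lj σ μ θP θD ξ lmo αP αD CP CD β γ X₀ X W M G) (hγ : 0 < γ)
    {fstar : ℝ} (hf : ∀ X, fstar ≤ globalLoss D F X)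
    (hζ : 3 / 2 * γ * (zeta ρlo ρhi αP αD β L (quadMean Lj) / 3) ≤ 1 / (4 * γ) - L / 2) (K : ℕ) :
    ∑ k ∈ Finset.range K, ∫ ω, dualNorm N (gradient (globalLoss D F) (X k ω)) ^ 2 ∂μ ≤
      8 / γ * psiZero μ D F fstar ρhi αD β γ X₀ (M 0) (G 0) +
        12 * ρhi ^ 2 * K * σ ^ 2 * (β / n + 12 * β ^ 3 / αD ^ 2 + 2 * β ^ 2 / αD) := by
  have hβ := h.beta_pos
  have hn := h.card_pos
  have hD0 := (h.workers 0 ⟨0, hn⟩).pos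
  have h1 := sum_gradient_le (ρlo := ρlo) (ρhi := ρhi) (αP := αP) (αD := αD) (β := β) (γ := γ)
    (L := L) (Lt := quadMean Lj) (s := σ ^ 2) (n := n) h.equiv.lo_pos (h.server 0).pos
    (h.server 0).le_one hD0 hβ hγ hζ
    (v := fun k => ∫ ω, N (X k ω - W k ω) ^ 2 ∂μ)
    (p := fun k => ∫ ω, ‖gradient (globalLoss D F) (X k ω) - avg fun j => M k j ω‖ ^ 2 ∂μ)
    (q := fun k => 1 / (n : ℝ) * ∑ j,
      ∫ ω, ‖gradient (localLoss D F j) (X k ω) - M k j ω‖ ^ 2 ∂μ)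
    (d := fun k => 1 / (n : ℝ) * ∑ j, ∫ ω, ‖M k j ω - G k j ω‖ ^ 2 ∂μ)
    (τ := fun k => ∫ ω, (γ * dualNorm N (avg fun j => G k j ω)) ^ 2 ∂μ)
    (g := fun k => ∫ ω, dualNorm N (gradient (globalLoss D F) (X k ω)) ^ 2 ∂μ)
    (φ := fun k => ∫ ω, globalLoss D F (X k ω) ∂μ) (fstar := fstar)
    (fun k => integral_nonneg fun _ => by positivity)
    (fun k => integral_nonneg fun _ => by positivity)
    (fun k => mul_nonneg (by positivity) (Finset.sum_nonneg fun j _ =>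
      integral_nonneg fun _ => by positivity))
    (fun k => mul_nonneg (by positivity) (Finset.sum_nonneg fun j _ =>
      integral_nonneg fun _ => by positivity))
    (fun k => integral_nonneg fun _ => by positivity)
    (by simp [h.run.X_zero, h.run.W_zero])
    (fun k => by
      have := integral_mono (integrable_const fstar)
        (h.smooth.integrable_comp h.equiv hf (h.memLp k).1) fun ω => hf (X k ω)
      simpa using this)
    h.server_recursion h.global_momentum_recursion
    (fun k => by
      -- Only $L_j^2$ and the momentum errors depend on `j`; with $L_j^2$ factored out, averaging
      -- produces $\tilde L^2$. The summand `0 * 0` fills an unused slot.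
      have := average_le hn (fun j => (h.local_momentum_recursion k j).trans_eq
        (show _ = (1 - β) * (∫ ω, ‖gradient (localLoss D F j) (X k ω) - M k j ω‖ ^ 2 ∂μ) + 0 * 0 +
          (2 / β * (1 / ρlo ^ 2 * ∫ ω, (γ * dualNorm N (avg fun j => G k j ω)) ^ 2 ∂μ) +
            2 * β * (1 / ρlo ^ 2 * ∫ ω, N (X (k + 1) ω - W (k + 1) ω) ^ 2 ∂μ)) * Lj j ^ 2 +
          β ^ 2 * σ ^ 2 by ring))
      rw [← quadMean_sq] at this
      refine this.trans_eq ?_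
      ring)
    (fun k => by
      have := average_le hn (fun j => (h.compression_recursion k j).trans_eq
        (show _ = (1 - αD / 2) * (∫ ω, ‖M k j ω - G k j ω‖ ^ 2 ∂μ) +
          6 / αD * β ^ 2 * (∫ ω, ‖gradient (localLoss D F j) (X k ω) - M k j ω‖ ^ 2 ∂μ) +
          (6 / αD * β ^ 2 * (1 / ρlo ^ 2 * ∫ ω, (γ * dualNorm N (avg fun j => G k j ω)) ^ 2 ∂μ) +
            6 / αD * β ^ 2 * (1 / ρlo ^ 2 *
              ∫ ω, N (X (k + 1) ω - W (k + 1) ω) ^ 2 ∂μ)) * Lj j ^ 2 +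
          β ^ 2 * σ ^ 2 by ring))
      rw [← quadMean_sq] at this
      refine this.trans_eq ?_
      ring)
    (h.descent_recursion hγ hf) K
  simp only [h.run.X_zero, integral_const, probReal_univ, one_smul] at h1
  have hp : 0 ≤ ∫ ω, ‖gradient (globalLoss D F) X₀ - avg fun j => M 0 j ω‖ ^ 2 ∂μ :=
    integral_nonneg fun _ => by positivity
  have hq : 0 ≤ 1 / (n : ℝ) * ∑ j, ∫ ω, ‖gradient (localLoss D F j) X₀ - M 0 j ω‖ ^ 2 ∂μ :=
    mul_nonneg (by positivity) (Finset.sum_nonneg fun j _ => integral_nonneg fun _ => by positivity)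
  have hd : 0 ≤ 1 / (n : ℝ) * ∑ j, ∫ ω, ‖M 0 j ω - G 0 j ω‖ ^ 2 ∂μ :=
    mul_nonneg (by positivity) (Finset.sum_nonneg fun j _ => integral_nonneg fun _ => by positivity)
  unfold psiZero
  generalize ∫ ω, ‖gradient (globalLoss D F) X₀ - avg fun j => M 0 j ω‖ ^ 2 ∂μ = p at *
  generalize 1 / (n : ℝ) * ∑ j, ∫ ω, ‖gradient (localLoss D F j) X₀ - M 0 j ω‖ ^ 2 ∂μ = q at *
  generalize 1 / (n : ℝ) * ∑ j, ∫ ω, ‖M 0 j ω - G 0 j ω‖ ^ 2 ∂μ = d at *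
  -- The summation needs weights $3/2$, $18$, $3$ on the initial errors `p`, `q`, `d`; those in
  -- $\Psi^0$ are $6$, $72$, $6$.
  have h2 : 3 / 2 * γ * ρhi ^ 2 * (p / β + 2 * d / αD + 12 * β / αD ^ 2 * q) ≤
      6 * ρhi ^ 2 / β * γ * p + 72 * ρhi ^ 2 * β / αD ^ 2 * γ * q + 6 * ρhi ^ 2 / αD * γ * d := by
    have e1 : 6 * ρhi ^ 2 / β * γ * p + 72 * ρhi ^ 2 * β / αD ^ 2 * γ * q +
        6 * ρhi ^ 2 / αD * γ * d -
        3 / 2 * γ * ρhi ^ 2 * (p / β + 2 * d / αD + 12 * β / αD ^ 2 * q) =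
        γ * ρhi ^ 2 * (9 / 2 * (p / β) + 3 * (d / αD) + 54 * (β / αD ^ 2 * q)) := by ring
    have e2 : 0 ≤ γ * ρhi ^ 2 * (9 / 2 * (p / β) + 3 * (d / αD) + 54 * (β / αD ^ 2 * q)) := by
      positivity
    linarith
  rw [← mul_le_mul_iff_of_pos_left (by positivity : 0 < γ / 8)]
  refine h1.trans ?_
  have e3 : ∀ y z : ℝ, γ / 8 * (8 / γ * y + 12 * ρhi ^ 2 * K * σ ^ 2 * z) =
      y + 3 / 2 * γ * ρhi ^ 2 * (K * σ ^ 2 * z) := by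
    intro y z
    field_simp
    ring
  rw [e3, mul_add (3 / 2 * γ * ρhi ^ 2)]
  linarith

end Convergence

end EF21Muon

theorem mainTheorem9 :
    ∃ C : ℝ, 0 < C ∧
      -- the parameter space with its Euclidean structure and the second norm `N`
      ∀ {E : Type*} [NormedAddCommGroup E] [InnerProductSpace ℝ E] [CompleteSpace E]
        [FiniteDimensional ℝ E] [Nontrivial E] [MeasurableSpace E] [BorelSpace E]
        (N : Seminorm ℝ E) (ρlo ρhi : ℝ) (_ : EF21Muon.NormEquivalence N ρlo ρhi)
        -- the problem
        (n : ℕ) (_ : 0 < n) (Ξ : Fin n → Type*) [∀ j, MeasurableSpace (Ξ j)]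
        (D : ∀ j, Measure (Ξ j)) (F : ∀ j, E → Ξ j → ℝ)
        (fstar : ℝ) (_ : ∀ X, fstar ≤ EF21Muon.globalLoss D F X)
        (L : ℝ) (_ : EF21Muon.IsSmooth N L (EF21Muon.globalLoss D F))
        (Lj : Fin n → ℝ) (_ : ∀ j, EF21Muon.IsSmooth N (Lj j) (EF21Muon.localLoss D F j))
        (_ : L ≤ EF21Muon.quadMean Lj)
        (σ : ℝ) (_ : EF21Muon.BoundedVariance D F σ)
        -- the randomness, the oracle and the compressors
        {Ω ΘP ΘD : Type*} [MeasurableSpace Ω] [MeasurableSpace ΘP] [MeasurableSpace ΘD]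
        (μ : Measure Ω) [IsProbabilityMeasure μ]
        (θP : ℕ → Ω → ΘP) (θD : ℕ → Ω → ΘD) (ξ : ℕ → ∀ j, Ω → Ξ j)
        (lmo : E → ℝ → E → E)
        (_ : Measurable (fun q : E × ℝ × E => lmo q.1 q.2.1 q.2.2))
        (_ : ∀ c t G, 0 ≤ t → EF21Muon.IsLMO N c t G (lmo c t G))
        (αP αD : ℝ) (CP : ℕ → ΘP → E → E) (CD : ℕ → Fin n → ΘD → E → E)
        (_ : ∀ k, EF21Muon.IsContractive N αP (μ.map (θP k)) (CP k))
        (_ : ∀ k j, EF21Muon.IsContractive (normSeminorm ℝ E) αD (μ.map (θD k)) (CD k j))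
        -- the run of the algorithm
        (β γ : ℝ) (X₀ : E) (X W : ℕ → Ω → E) (M G : ℕ → Fin n → Ω → E)
        (_ : EF21Muon.IsRandomness μ D θP θD ξ (M 0) (G 0))
        (_ : EF21Muon.IsRun N F β γ lmo CP CD θP θD ξ X₀ X W M G)
        -- the choice of the parameters
        (K : ℕ) (_ : 1 ≤ K) (Ψ : ℝ)
        (_ : Ψ = EF21Muon.psiZero μ D F fstar ρhi αD β γ X₀ (M 0) (G 0))
        (_ : 0 < β) (_ : β = EF21Muon.momentumChoice Ψ L ρlo σ αD n K)
        (_ : γ = 1 / (Real.sqrt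
          (2 * EF21Muon.zeta ρlo ρhi αP αD β L (EF21Muon.quadMean Lj)) + 2 * L)),
        γ⁻¹ ≤ C * (ρhi ^ 2 * L / (ρlo ^ 2 * β)
            + ρhi ^ 2 * EF21Muon.quadMean Lj / (ρlo ^ 2 * αP * αD)) ∧
        (∀ k, Integrable
          (fun ω => EF21Muon.dualNorm N (gradient (EF21Muon.globalLoss D F) (X k ω)) ^ 2) μ) ∧
        (1 / (K : ℝ)) * ∑ k ∈ Finset.range K,
            ∫ ω, EF21Muon.dualNorm N (gradient (EF21Muon.globalLoss D F) (X k ω)) ^ 2 ∂μ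
          ≤ C * EF21Muon.rate Ψ L (EF21Muon.quadMean Lj) ρlo ρhi σ αP αD n K := by
  refine ⟨1000, by norm_num, ?_⟩
  intro E _ _ _ _ _ _ _ N ρlo ρhi hN n hn Ξ _ D F fstar hf L hL Lj hLj hLt σ hσ Ω ΘP ΘD _ _ _ μ _
    θP θD ξ lmo hlm hlmo αP αD CP CD hCP hCD β γ X₀ X W M G hR hrun K hK Ψ hΨ hβ0 hβ hγ
  have hP0 := (hCP 0).pos
  have hP1 := (hCP 0).le_one
  have hD0 := (hCD 0 ⟨0, hn⟩).pos
  have hD1 := (hCD 0 ⟨0, hn⟩).le_one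
  have hβ1 : β ≤ 1 := hβ.le.trans (EF21Muon.momentumChoice_le_one _ _ _ _ _ _ _)
  have hL0 := hL.nonneg
  have hLt0 := hL0.trans hLt
  have hlo := hN.lo_pos
  have hhi := hN.hi_pos
  have hγ0 : 0 ≤ γ := by
    rw [hγ]
    positivity
  have hm : EF21Muon.Model N ρlo ρhi D F L Lj σ μ θP θD ξ lmo αP αD CP CD β γ X₀ X W M G :=
    ⟨hN, hn, hL, hLj, hσ, hlm, hlmo, hCP, hCD, hR, hrun, hβ0, hβ1, hγ0⟩
  have hΨ0 : 0 ≤ Ψ := hΨ ▸ hm.psiZero_nonneg hf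
  have hinv := EF21Muon.inv_stepsize_le hlo hN.lo_le_hi hP0 hP1 hD0 hD1 hβ0 hβ1 hL0 hLt hγ
  have hn' : (0 : ℝ) < n := by exact_mod_cast hn
  have hK' : (0 : ℝ) < K := by exact_mod_cast hK
  refine ⟨hinv.trans ?_, hm.integrable_dualNorm_gradient_sq, ?_⟩
  · gcongr
    norm_num
  -- A zero stepsize can only come from the convention $1/0=0$, which forces $L=0$; all gradients of
  -- $f$ then vanish.
  rcases hγ0.eq_or_lt with h0 | h0
  · have hL00 : L = 0 := by
      rw [← h0] at hγ
      have h1 := div_eq_zero_iff.1 hγ.symm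
      have h2 := Real.sqrt_nonneg
        (2 * EF21Muon.zeta ρlo ρhi αP αD β L (EF21Muon.quadMean Lj))
      rcases h1 with h1 | h1
      · norm_num at h1
      · linarith
    subst hL00
    have h1 : EF21Muon.dualNorm N (0 : E) = 0 :=
      le_antisymm (EF21Muon.dualNorm_le (by simp)) (hN.dualNorm_nonneg 0)
    simp only [hL.gradient_eq_zero hN hf, h1, ne_eq, OfNat.ofNat_ne_zero, not_false_eq_true,
      zero_pow, integral_zero, Finset.sum_const_zero, mul_zero]
    exact mul_nonneg (by norm_num)
      (EF21Muon.rate_nonneg hΨ0 le_rfl hLt hlo hhi hσ.sigma_nonneg hP0 hD0)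
  · have h1 := hm.sum_dualNorm_gradient_le h0 hf (EF21Muon.stepsize_condition
      (EF21Muon.zeta_nonneg _ _ _ _ _ _ hβ0) hL0 h0 hγ) K
    rw [← hΨ] at h1
    refine le_trans ?_ (EF21Muon.le_rate hΨ0 hL0 hLt hlo hhi hσ.sigma_nonneg hP0 hP1 hD0 hD1 hn
      hK hβ0 hβ)
    calc _ ≤ 1 / (K : ℝ) * (8 / γ * Ψ + 12 * ρhi ^ 2 * K * σ ^ 2 *
          (β / n + 12 * β ^ 3 / αD ^ 2 + 2 * β ^ 2 / αD)) := by gcongr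
      _ = 8 * γ⁻¹ * Ψ / K + 12 * ρhi ^ 2 * σ ^ 2 *
          (β / n + 12 * β ^ 3 / αD ^ 2 + 2 * β ^ 2 / αD) := by
        field_simp
      _ ≤ _ := by gcongr
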